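/- For an $N\times N$ complex matrix $M$ write $\langle M\rangle := N^{-1}\operatorname{Tr} M$, $\mathring{M} := M-\langle M\rangle I$ and $\Im M := (M-M^*)/(2\mathrm{i})$. Let $H=W+B$ be a deformed Wigner matrix, where $W$ is an $N\times N$ Wigner matrix and $B=B^*$ is deterministic with operator norm $\|B\|\le C_0$, let $A=A^*$ be deterministic, and let $H^x:=H+xA$ for $x\in\mathbf{R}$. For $z\in\mathbf{C}$ with $\Im z>0$ let $M^x(z)$ be the unique solution of the matrix Dyson equation \[ -M^{-1}=z-B-xA+\langle M\rangle,\qquad (\Im z)\,\Im M>0 , \] let \[ \rho^x(E):=\lim_{\eta\to 0^+}\frac1\pi\langle \Im M^x(E+\mathrm{i}\eta)\rangle,\qquad E\in\mathbf{R}, \] be the self-consistent density of states of $H^x$ (it depends on $B$, $A$, $x$ only), and let its quantiles $\gamma_i^x$ be given by $\int_{-\infty}^{\gamma_i^x}\rho^x(\tau)\,\mathrm{d}\tau=i/N$, $i\in\{1,\dots,N\}$. For every $c_1>0$ there exists $c^*=c^*(c_1)>0$ such that for every $C_0$ there is a constant $C=C(c_1,C_0)>0$ with the following property. For all $N$, all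 Hermitian $N\times N$ matrices $B$, $A$ with $\|B\|\le C_0$, all $x_1,x_2\in\mathbf{R}$ with $|x_1-x_2|\le c^*$, and every index $i\in\{1,\dots,N\}$ in the $c_1$-bulk, i.e. with $\rho^{x_r}(\gamma_i^{x_r})\ge c_1$ for $r=1,2$, it holds that \[ \bigl|\gamma_i^{x_1}-\gamma_i^{x_2}-(x_1-x_2)\langle A\rangle\bigr|\le C\Bigl(|x_1-x_2|\,\langle\mathring{A}^2\rangle^{1/2}+|x_1-x_2|^2\Bigr). \] -/

import Mathlib

open Filter
open scoped ComplexOrder ComplexStarModule Topology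

noncomputable section

namespace Monoparametric

/-- The normalized trace `⟨M⟩ = N⁻¹ Tr M`. -/
def normTr {N : ℕ} (M : Matrix (Fin N) (Fin N) ℂ) : ℂ :=
  (N : ℂ)⁻¹ * M.trace

/-- The traceless part `M - ⟨M⟩` of a matrix. -/
def traceless {N : ℕ} (M : Matrix (Fin N) (Fin N) ℂ) : Matrix (Fin N) (Fin N) ℂ :=
  M - normTr M • (1 : Matrix (Fin N) (Fin N) ℂ)

/-- `M` solves the matrix Dyson equation `-M⁻¹ = z - D + ⟨M⟩`, `(Im z) (Im M) > 0`, with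
deterministic part `D` at the spectral parameter `z`. Here `ℑ M = (M - M*) / (2i)`. -/
structure IsMDESolution {N : ℕ} (D : Matrix (Fin N) (Fin N) ℂ) (z : ℂ)
    (M : Matrix (Fin N) (Fin N) ℂ) : Prop where
  isUnit : IsUnit M
  eqn : -M⁻¹ = z • (1 : Matrix (Fin N) (Fin N) ℂ) - D
    + normTr M • (1 : Matrix (Fin N) (Fin N) ℂ)
  pos : (z.im • (ℑ M : Matrix (Fin N) (Fin N) ℂ)).PosDef

theorem im_of_inv {N : ℕ} {D M : Matrix (Fin N) (Fin N) ℂ} (hD : D.IsHermitian) {w : ℂ}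
    (hM : (D - w • (1 : Matrix (Fin N) (Fin N) ℂ)) * M = 1) :
    (ℑ M : Matrix (Fin N) (Fin N) ℂ) = w.im • (M.conjTranspose * M) := by
  have hDM : D * M = 1 + w • M := by
    rw [sub_mul, smul_mul_assoc, one_mul] at hM
    rw [← hM]; abel
  have hMD : M.conjTranspose * D = 1 + star w • M.conjTranspose := by
    have := congrArg Matrix.conjTranspose hDM
    rwa [Matrix.conjTranspose_mul, hD.eq, Matrix.conjTranspose_add, Matrix.conjTranspose_one,
      Matrix.conjTranspose_smul] at this
  have h1 : M.conjTranspose * (D * M) = M.conjTranspose + w • (M.conjTranspose * M) := by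
    rw [hDM, mul_add, mul_one, mul_smul_comm]
  have h2 : M.conjTranspose * (D * M) = M + star w • (M.conjTranspose * M) := by
    rw [← mul_assoc, hMD, add_mul, one_mul, smul_mul_assoc]
  have h3 : M - M.conjTranspose = (w - star w) • (M.conjTranspose * M) := by
    rw [sub_smul, sub_eq_sub_iff_add_eq_add, ← h2, h1]; abel
  rw [imaginaryPart_apply_coe, Matrix.star_eq_conjTranspose, h3]
  ext a b
  simp only [Matrix.smul_apply, smul_eq_mul, Complex.real_smul]
  have hw : w - star w = 2 * w.im * Complex.I := by
    apply Complex.ext <;> (simp; try ring)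
  rw [hw]
  push_cast
  linear_combination (-(w.im : ℂ) * (M.conjTranspose * M) a b) * Complex.I_mul_I

/-- Some `w` in the upper half plane satisfies `w = z + N⁻¹ ∑ᵢ (lᵢ - w)⁻¹`. -/
theorem exists_root {N : ℕ} (l : Fin N → ℝ) {z : ℂ} (hz : 0 < z.im) :
    ∃ w : ℂ, 0 < w.im ∧ w = z + (N : ℂ)⁻¹ * ∑ i, ((l i : ℂ) - w)⁻¹ := by
  rcases Nat.eq_zero_or_pos N with rfl | hN
  · exact ⟨z, hz, by simp⟩
  open Polynomial in
  set p : ℂ[X] := ∏ i : Fin N, (X - C (l i : ℂ)) with hp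
  have hpm : p.Monic := monic_prod_of_monic _ _ fun i _ => monic_X_sub_C _
  have hpd : p.natDegree = N := by
    rw [hp, natDegree_prod_of_monic _ _ fun i _ => monic_X_sub_C _]; simp
  set r : ℂ[X] := (X - C z) * p with hr
  have hrm : r.Monic := (monic_X_sub_C z).mul hpm
  have hrd : r.natDegree = N + 1 := by
    rw [hr, (monic_X_sub_C z).natDegree_mul hpm, hpd, natDegree_X_sub_C]; ring
  set d : ℂ[X] := C ((N : ℂ)⁻¹) * derivative p with hd
  have hdd : d.natDegree < N := by
    refine lt_of_le_of_lt (natDegree_C_mul_le _ _) ?_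
    have := natDegree_derivative_lt (p := p) (by omega)
    omega
  have hqm : (r + d).Monic := hrm.add_of_left (by
    apply degree_lt_degree; omega)
  have hqd : (r + d).natDegree = N + 1 := by
    rw [natDegree_add_eq_left_of_natDegree_lt (by omega), hrd]
  have hnext : (r + d).nextCoeff = -(z + ∑ i, (l i : ℂ)) := by
    have h1 : (r + d).nextCoeff = r.nextCoeff := by
      rw [nextCoeff_of_natDegree_pos (by omega), nextCoeff_of_natDegree_pos (by omega), hqd, hrd,
        coeff_add]
      simp [coeff_eq_zero_of_natDegree_lt hdd]
    rw [h1, hr, (monic_X_sub_C z).nextCoeff_mul hpm, nextCoeff_X_sub_C, hp,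
      Monic.nextCoeff_prod _ _ fun i _ => monic_X_sub_C _]
    simp [nextCoeff_X_sub_C]; ring
  have hsum : (r + d).roots.sum = z + ∑ i, (l i : ℂ) := by
    have := (IsAlgClosed.splits (r + d)).nextCoeff_eq_neg_sum_roots_of_monic hqm
    rw [hnext] at this
    exact (neg_injective this).symm
  obtain ⟨w, hw, hwim⟩ : ∃ w ∈ (r + d).roots, 0 < w.im := by
    by_contra! hcon
    have h1 : ((r + d).roots.map Complex.im).sum ≤ 0 :=
      Multiset.sum_induction (fun y : ℝ => y ≤ 0) _ (fun _ _ => add_nonpos) le_rfl fun y hy => by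
        obtain ⟨w, hw, rfl⟩ := Multiset.mem_map.1 hy
        exact hcon w hw
    have h2 : ((r + d).roots.map Complex.im).sum = (r + d).roots.sum.im :=
      (map_multiset_sum Complex.imAddGroupHom (r + d).roots).symm
    rw [h2, hsum] at h1
    simp at h1
    linarith
  have hne : ∀ i, w - (l i : ℂ) ≠ 0 := fun i h => by
    have := congrArg Complex.im h
    simp at this
    linarith
  have hroot : (w - z) * p.eval w + (N : ℂ)⁻¹ * (derivative p).eval w = 0 := by
    have := (mem_roots'.1 hw).2
    simpa [IsRoot, hr, hd] using this
  have hpe : p.eval w ≠ 0 := by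
    rw [hp, eval_prod]
    exact Finset.prod_ne_zero_iff.2 fun i _ => by simpa using hne i
  have hder : (derivative p).eval w = p.eval w * ∑ i, (w - (l i : ℂ))⁻¹ := by
    rw [hp, derivative_prod_finset, eval_finsetSum, Finset.mul_sum]
    refine Finset.sum_congr rfl fun i hi => ?_
    rw [eval_prod, ← Finset.mul_prod_erase _ _ hi, eval_mul, eval_prod]
    have := hne i
    simp
    field_simp
  refine ⟨w, hwim, ?_⟩
  have hs : ∑ i, ((l i : ℂ) - w)⁻¹ = -∑ i, (w - (l i : ℂ))⁻¹ := by
    rw [← Finset.sum_neg_distrib]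
    refine Finset.sum_congr rfl fun i _ => ?_
    rw [← neg_sub, inv_neg]
  rw [hder] at hroot
  have : (w - z) + (N : ℂ)⁻¹ * ∑ i, (w - (l i : ℂ))⁻¹ = 0 := by
    apply mul_left_cancel₀ hpe
    linear_combination hroot
  rw [hs]
  linear_combination this

theorem exists_isMDESolution {N : ℕ} {D : Matrix (Fin N) (Fin N) ℂ} (hD : D.IsHermitian) {z : ℂ}
    (hz : 0 < z.im) : ∃ M, IsMDESolution D z M := by
  obtain ⟨w, hw, hwz⟩ := exists_root hD.eigenvalues hz
  have hne : ∀ i, (hD.eigenvalues i : ℂ) - w ≠ 0 := fun i h => by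
    have := congrArg Complex.im h
    simp at this
    linarith
  set U : Matrix (Fin N) (Fin N) ℂ := (hD.eigenvectorUnitary : Matrix (Fin N) (Fin N) ℂ) with hU
  have hUU : star U * U = 1 := Unitary.coe_star_mul_self hD.eigenvectorUnitary
  have hUU' : U * star U = 1 := Unitary.coe_mul_star_self hD.eigenvectorUnitary
  set L : Matrix (Fin N) (Fin N) ℂ := Matrix.diagonal fun i => (hD.eigenvalues i : ℂ) with hL
  set R : Matrix (Fin N) (Fin N) ℂ :=
    Matrix.diagonal fun i => ((hD.eigenvalues i : ℂ) - w)⁻¹ with hR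
  have hDU : D = U * L * star U := by
    have := hD.spectral_theorem
    rw [Unitary.conjStarAlgAut_apply] at this
    exact this
  have hLR : (L - w • (1 : Matrix (Fin N) (Fin N) ℂ)) * R = 1 := by
    rw [hL, hR, ← Matrix.diagonal_one, ← Matrix.diagonal_smul, Matrix.diagonal_sub,
      Matrix.diagonal_mul_diagonal]
    congr 1
    ext i
    simp [hne i]
  have hMinv : (D - w • (1 : Matrix (Fin N) (Fin N) ℂ)) * (U * R * star U) = 1 := by
    have : D - w • (1 : Matrix (Fin N) (Fin N) ℂ)
        = U * (L - w • (1 : Matrix (Fin N) (Fin N) ℂ)) * star U := by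
      rw [mul_sub, sub_mul, ← hDU, mul_smul_comm, smul_mul_assoc, mul_one, hUU']
    rw [this]
    calc U * (L - w • (1 : Matrix (Fin N) (Fin N) ℂ)) * star U * (U * R * star U)
        = U * (L - w • (1 : Matrix (Fin N) (Fin N) ℂ)) * (star U * U) * R * star U := by
          simp only [mul_assoc]
      _ = U * ((L - w • (1 : Matrix (Fin N) (Fin N) ℂ)) * R) * star U := by
          rw [hUU]; simp only [mul_assoc, one_mul]
      _ = 1 := by rw [hLR, mul_one, hUU']
  have htr : normTr (U * R * star U) = w - z := by
    rw [normTr, mul_assoc, Matrix.trace_mul_comm, mul_assoc, hUU, mul_one, hR,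
      Matrix.trace_diagonal]
    linear_combination -hwz
  have hunit : IsUnit (U * R * star U) := IsUnit.of_mul_eq_one_right _ hMinv
  refine ⟨U * R * star U, hunit, ?_, ?_⟩
  · rw [Matrix.inv_eq_left_inv hMinv, htr, sub_smul]
    abel
  · rw [im_of_inv hD hMinv, smul_smul]
    exact (Matrix.PosDef.conjTranspose_mul_self _
      (Matrix.mulVec_injective_of_isUnit hunit)).smul (mul_pos hz hw)

theorem IsMDESolution.inv_mul {N : ℕ} {D M : Matrix (Fin N) (Fin N) ℂ} {z : ℂ}
    (h : IsMDESolution D z M) :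
    (D - (z + normTr M) • (1 : Matrix (Fin N) (Fin N) ℂ)) * M = 1 := by
  have h1 : D - (z + normTr M) • (1 : Matrix (Fin N) (Fin N) ℂ) = M⁻¹ := by
    rw [← neg_neg M⁻¹, h.eqn, add_smul]; abel
  rw [h1, Matrix.nonsing_inv_mul _ ((Matrix.isUnit_iff_isUnit_det _).1 h.isUnit)]

theorem normTr_im {N : ℕ} (M : Matrix (Fin N) (Fin N) ℂ) :
    (normTr (ℑ M : Matrix (Fin N) (Fin N) ℂ)).re = (normTr M).im := by
  have h : (ℑ M : Matrix (Fin N) (Fin N) ℂ).trace = (M.trace.im : ℂ) := by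
    rw [imaginaryPart_apply_coe, Matrix.star_eq_conjTranspose, Matrix.trace_smul,
      Matrix.trace_smul, Matrix.trace_sub, Matrix.trace_conjTranspose]
    apply Complex.ext <;> (simp; try ring)
  have hN : (N : ℂ)⁻¹ = ((N : ℝ)⁻¹ : ℝ) := by push_cast; rfl
  rw [normTr, normTr, h, hN, Complex.re_ofReal_mul, Complex.im_ofReal_mul, Complex.ofReal_re]

theorem trace_conjTranspose_mul {N : ℕ} (M : Matrix (Fin N) (Fin N) ℂ) :
    (M.conjTranspose * M).trace = ((∑ i, ∑ j, ‖M i j‖ ^ 2 : ℝ) : ℂ) := by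
  rw [Matrix.trace, Finset.sum_comm]
  push_cast
  refine Finset.sum_congr rfl fun i _ => ?_
  rw [Matrix.diag_apply, Matrix.mul_apply]
  refine Finset.sum_congr rfl fun j _ => ?_
  rw [Matrix.conjTranspose_apply, Complex.star_def, Complex.conj_mul']

/-- `⟨M* M⟩ < 1`. -/
theorem IsMDESolution.sum_sq_lt {N : ℕ} (hN : 0 < N) {D M : Matrix (Fin N) (Fin N) ℂ} {z : ℂ}
    (hD : D.IsHermitian) (hz : 0 < z.im) (h : IsMDESolution D z M) :
    (N : ℝ)⁻¹ * ∑ i, ∑ j, ‖M i j‖ ^ 2 < 1 := by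
  have him := normTr_im M
  have hN' : (N : ℂ)⁻¹ = ((N : ℝ)⁻¹ : ℝ) := by push_cast; rfl
  have hpos : 0 < (normTr M).im := by
    have : Nonempty (Fin N) := ⟨⟨0, hN⟩⟩
    have ht := h.pos.trace_pos
    rw [Matrix.trace_smul, Complex.real_smul, Complex.pos_iff, Complex.re_ofReal_mul] at ht
    rw [← him, normTr, hN', Complex.re_ofReal_mul]
    exact mul_pos (by positivity) (pos_of_mul_pos_right ht.1 hz.le)
  rw [im_of_inv hD h.inv_mul, normTr, Matrix.trace_smul, trace_conjTranspose_mul,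
    Complex.real_smul, hN', Complex.re_ofReal_mul, Complex.re_ofReal_mul, Complex.ofReal_re,
    Complex.add_im] at him
  by_contra! hge
  nlinarith

/-- For Hermitian `D` and `Im z > 0` the matrix Dyson equation has exactly one solution. -/
theorem existsUnique_isMDESolution {N : ℕ} {D : Matrix (Fin N) (Fin N) ℂ} (hD : D.IsHermitian)
    {z : ℂ} (hz : 0 < z.im) : ∃! M, IsMDESolution D z M := by
  obtain ⟨M, hM⟩ := exists_isMDESolution hD hz
  refine ⟨M, hM, fun M' hM' => ?_⟩
  rcases Nat.eq_zero_or_pos N with rfl | hN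
  · ext i; exact i.elim0
  have h1 := mul_eq_one_comm.1 hM'.inv_mul
  have h2 := hM.inv_mul
  have hdiff : M' - M = (normTr M' - normTr M) • (M' * M) := by
    have e1 : M' * D * M = M + (z + normTr M') • (M' * M) := by
      have : M' * D = 1 + (z + normTr M') • M' := by
        rw [← h1, mul_sub, mul_smul_comm, mul_one]; abel
      rw [this, add_mul, one_mul, smul_mul_assoc]
    have e2 : M' * D * M = M' + (z + normTr M) • (M' * M) := by
      have : D * M = 1 + (z + normTr M) • M := by
        rw [← h2, sub_mul, smul_mul_assoc, one_mul]; abel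
      rw [mul_assoc, this, mul_add, mul_one, mul_smul_comm]
    have e3 := e1.symm.trans e2
    rw [add_smul, add_smul] at e3
    rw [sub_smul, sub_eq_sub_iff_add_eq_add]
    have := congrArg (fun Y => Y - z • (M' * M)) e3
    calc M' + normTr M • (M' * M)
        = M' + (z • (M' * M) + normTr M • (M' * M)) - z • (M' * M) := by abel
      _ = M + (z • (M' * M) + normTr M' • (M' * M)) - z • (M' * M) := this.symm
      _ = normTr M' • (M' * M) + M := by abel
  have htr : normTr M' - normTr M = (normTr M' - normTr M) * normTr (M' * M) := by
    have := congrArg (fun Y => (N : ℂ)⁻¹ * Matrix.trace Y) hdiff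
    simp only [Matrix.trace_sub, Matrix.trace_smul, smul_eq_mul] at this
    rw [normTr, normTr] at *
    rw [normTr]
    linear_combination this
  have hlt : ‖normTr (M' * M)‖ < 1 := by
    have s1 := hM.sum_sq_lt hN hD hz
    have s2 := hM'.sum_sq_lt hN hD hz
    have hle : ‖(M' * M).trace‖ ≤ (∑ i, ∑ j, ‖M' i j‖ ^ 2 + ∑ i, ∑ j, ‖M i j‖ ^ 2) / 2 := by
      have : ∑ i, ∑ j, ‖M i j‖ ^ 2 = ∑ i, ∑ j, ‖M j i‖ ^ 2 := Finset.sum_comm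
      rw [this, Matrix.trace, ← Finset.sum_add_distrib, Finset.sum_div]
      refine (norm_sum_le _ _).trans (Finset.sum_le_sum fun i _ => ?_)
      rw [Matrix.diag_apply, Matrix.mul_apply, ← Finset.sum_add_distrib, Finset.sum_div]
      refine (norm_sum_le _ _).trans (Finset.sum_le_sum fun j _ => ?_)
      rw [norm_mul]
      nlinarith [sq_nonneg (‖M' i j‖ - ‖M j i‖)]
    have hNpos : (0 : ℝ) < (N : ℝ)⁻¹ := by positivity
    rw [normTr, norm_mul, norm_inv, Complex.norm_natCast]
    nlinarith [mul_le_mul_of_nonneg_left hle hNpos.le]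
  have hm : normTr M' - normTr M = 0 := by
    by_contra hne
    have : normTr (M' * M) = 1 := by
      apply mul_left_cancel₀ hne
      rw [← htr, mul_one]
    rw [this, norm_one] at hlt
    exact lt_irrefl _ hlt
  rw [hm, zero_smul] at hdiff
  exact sub_eq_zero.1 hdiff

/-- The solution of the matrix Dyson equation. For Hermitian `D` and `Im z > 0` it exists and is
unique, see `existsUnique_isMDESolution`. -/
def mdeSol {N : ℕ} (D : Matrix (Fin N) (Fin N) ℂ) (z : ℂ) : Matrix (Fin N) (Fin N) ℂ :=
  Classical.epsilon (IsMDESolution D z)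

theorem mdeSol_spec {N : ℕ} {D : Matrix (Fin N) (Fin N) ℂ} (hD : D.IsHermitian) {z : ℂ}
    (hz : 0 < z.im) : IsMDESolution D z (mdeSol D z) :=
  Classical.epsilon_spec (existsUnique_isMDESolution hD hz).exists

/-- The self-consistent density of states at the energy `E`,
`ρ(E) = lim_{η → 0+} π⁻¹ ⟨Im M(E + iη)⟩`. -/
def scDos {N : ℕ} (D : Matrix (Fin N) (Fin N) ℂ) (E : ℝ) : ℝ :=
  limUnder (𝓝[>] (0 : ℝ)) fun η : ℝ =>
    (1 / Real.pi) * (normTr (ℑ (mdeSol D (E + η * Complex.I)) : Matrix (Fin N) (Fin N) ℂ)).re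

/-- `γ` is an `i`-th `N`-quantile of the density `ρ`, that is, `∫_{-∞}^γ ρ = i / N`. -/
def IsQuantile (ρ : ℝ → ℝ) (N i : ℕ) (γ : ℝ) : Prop :=
  MeasureTheory.IntegrableOn ρ (Set.Iic γ) ∧ ∫ τ in Set.Iic γ, ρ τ = (i : ℝ) / N

end Monoparametric

end

open Monoparametric

/-! The Dyson equation only sees the eigenvalues `l` of its deterministic part. With `w = z + ⟨M⟩`
it becomes the subordination equation `w = z + ∑ qᵢ / (lᵢ - w)`. This is the critical point equation
of `logPotential` in `w`. Hence the imaginary part of the critical value, `phase`, has derivatives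
in atoms, weights and energy that contain no derivative of `w`. Its energy derivative is minus the
imaginary part of the Stieltjes transform, and it tends to `π` far to the left, so its boundary
values are `π (1 - F)` with `F` the distribution function (`HasDensity.tendsto_phase`).

Two deterministic parts `X`, `Y` are compared by giving their spectra common weights `N⁻¹ |⟨u_j,
v_k⟩|²` on pairs of eigenvectors (`exists_eigenvalue_coupling`). The mean square of `l' - l - α` is
then exactly `V = ⟨(Y - X - α)²⟩`. Moving the atoms linearly while shifting the energy by `α`
changes the phase by at most `σ = √V`, since the imaginary part of the subordination equation gives
`∑ qᵢ |lᵢ - w|⁻² < 1` (`abs_phase_sub_le`). So the distribution functions, compared at energies `E`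
and `E + α`, differ by at most `σ / π`.

In the bulk this becomes a bound on quantiles: the density is `1/3`-Hölder with a universal
constant, so it stays above `c / 2` on a window of length `c³`. This settles displacements below
`c³`. For larger ones `σ` is at least of order `c⁴`, and a Chebyshev argument
(`phase_le_add_div_sq`) bounds the displacement by a multiple of `σ` (`HasDensity.quantile_sub_le`).
With `Y - X = (x₁ - x₂) A` and `α = (x₁ - x₂) ⟨A⟩`, `σ` is `|x₁ - x₂|` times the normalized
Hilbert-Schmidt norm of the traceless part of `A`. -/

noncomputable section

namespace Monoparametric

/-! ### The subordination equation: existence, uniqueness, Hölder regularity -/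

section

variable {ι : Type*} [Fintype ι]

/-- `w` is a subordination point of `z`: it lies in the upper half plane and
`w = z + ∑ᵢ qᵢ / (lᵢ - w)`. -/
structure IsSubord (q l : ι → ℝ) (z w : ℂ) : Prop where
  im_pos : 0 < w.im
  eqn : w = z + ∑ i, (q i : ℂ) * ((l i : ℂ) - w)⁻¹

/-- Clearing denominators gives a monic polynomial whose perturbation term `d` has degree too low to
affect the sum of the roots. That sum is `z + ∑ lᵢ`, with positive imaginary part, so some root lies
in the upper half plane. -/
theorem exists_isSubord (q l : ι → ℝ) {z : ℂ} (hz : 0 < z.im) : ∃ w, IsSubord q l z w := by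
  classical
  rcases isEmpty_or_nonempty ι with hι | hι
  · exact ⟨z, hz, by simp⟩
  open Polynomial in
  set N := Fintype.card ι with hN
  have hNpos : 0 < N := Fintype.card_pos
  set p : ℂ[X] := ∏ i : ι, (X - C (l i : ℂ)) with hp
  have hpm : p.Monic := monic_prod_of_monic _ _ fun i _ => monic_X_sub_C _
  have hpd : p.natDegree = N := by
    rw [hp, natDegree_prod_of_monic _ _ fun i _ => monic_X_sub_C _]; simp [hN]
  set r : ℂ[X] := (X - C z) * p with hr
  have hrm : r.Monic := (monic_X_sub_C z).mul hpm
  have hrd : r.natDegree = N + 1 := by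
    rw [hr, (monic_X_sub_C z).natDegree_mul hpm, hpd, natDegree_X_sub_C]; ring
  set d : ℂ[X] := ∑ i, C (q i : ℂ) * ∏ j ∈ Finset.univ.erase i, (X - C (l j : ℂ)) with hd
  have hdd : d.natDegree < N := by
    have : d.natDegree ≤ N - 1 := by
      refine natDegree_sum_le_of_forall_le _ _ fun i _ => ?_
      refine (natDegree_C_mul_le _ _).trans ?_
      rw [natDegree_prod_of_monic _ _ fun i _ => monic_X_sub_C _]
      simp [hN]
    omega
  have hqm : (r + d).Monic := hrm.add_of_left (by
    apply degree_lt_degree; omega)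
  have hqd : (r + d).natDegree = N + 1 := by
    rw [natDegree_add_eq_left_of_natDegree_lt (by omega), hrd]
  have hnext : (r + d).nextCoeff = -(z + ∑ i, (l i : ℂ)) := by
    have h1 : (r + d).nextCoeff = r.nextCoeff := by
      rw [nextCoeff_of_natDegree_pos (by omega), nextCoeff_of_natDegree_pos (by omega), hqd, hrd,
        coeff_add]
      simp [coeff_eq_zero_of_natDegree_lt hdd]
    rw [h1, hr, (monic_X_sub_C z).nextCoeff_mul hpm, nextCoeff_X_sub_C, hp,
      Monic.nextCoeff_prod _ _ fun i _ => monic_X_sub_C _]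
    simp [nextCoeff_X_sub_C]; ring
  have hsum : (r + d).roots.sum = z + ∑ i, (l i : ℂ) := by
    have := (IsAlgClosed.splits (r + d)).nextCoeff_eq_neg_sum_roots_of_monic hqm
    rw [hnext] at this
    exact (neg_injective this).symm
  obtain ⟨w, hw, hwim⟩ : ∃ w ∈ (r + d).roots, 0 < w.im := by
    by_contra! hcon
    have h1 : ((r + d).roots.map Complex.im).sum ≤ 0 :=
      Multiset.sum_induction (fun y : ℝ => y ≤ 0) _ (fun _ _ => add_nonpos) le_rfl fun y hy => by
        obtain ⟨w, hw, rfl⟩ := Multiset.mem_map.1 hy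
        exact hcon w hw
    have h2 : ((r + d).roots.map Complex.im).sum = (r + d).roots.sum.im :=
      (map_multiset_sum Complex.imAddGroupHom (r + d).roots).symm
    rw [h2, hsum] at h1
    simp at h1
    linarith
  have hne : ∀ i, w - (l i : ℂ) ≠ 0 := fun i h => by
    have := congrArg Complex.im h
    simp at this
    linarith
  have hroot : (w - z) * p.eval w + d.eval w = 0 := by
    have := (mem_roots'.1 hw).2
    simpa [IsRoot, hr] using this
  have hpe : p.eval w ≠ 0 := by
    rw [hp, eval_prod]
    exact Finset.prod_ne_zero_iff.2 fun i _ => by simpa using hne i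
  have hde : d.eval w = - (p.eval w * ∑ i, (q i : ℂ) * ((l i : ℂ) - w)⁻¹) := by
    rw [hd, eval_finsetSum, Finset.mul_sum, ← Finset.sum_neg_distrib]
    refine Finset.sum_congr rfl fun i hi => ?_
    rw [hp, eval_prod, ← Finset.mul_prod_erase _ _ hi, eval_mul, eval_prod, ← neg_sub w, inv_neg]
    have := hne i
    simp
    field_simp
  refine ⟨w, hwim, ?_⟩
  rw [hde] at hroot
  have : (w - z) - ∑ i, (q i : ℂ) * ((l i : ℂ) - w)⁻¹ = 0 := by
    apply mul_left_cancel₀ hpe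
    linear_combination hroot
  linear_combination this

theorem ofReal_sub_ne_zero (a : ℝ) {w : ℂ} (hw : 0 < w.im) : (a : ℂ) - w ≠ 0 := fun h => by
  have := congrArg Complex.im h
  simp at this
  linarith

theorem im_inv_ofReal_sub (a : ℝ) (w : ℂ) :
    ((a : ℂ) - w)⁻¹.im = w.im * ‖((a : ℂ) - w)⁻¹‖ ^ 2 := by
  rw [Complex.inv_im, norm_inv, inv_pow, Complex.sq_norm]
  simp [div_eq_mul_inv]

theorem sq_sum_mul_le {q : ι → ℝ} (hq : ∀ i, 0 ≤ q i) (hq1 : ∑ i, q i ≤ 1) (x : ι → ℝ) :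
    (∑ i, q i * x i) ^ 2 ≤ ∑ i, q i * x i ^ 2 := by
  have h := Finset.sum_sq_le_sum_mul_sum_of_sq_le_mul Finset.univ (r := fun i => q i * x i)
    (f := q) (g := fun i => q i * x i ^ 2) (fun i _ => hq i)
    (fun i _ => mul_nonneg (hq i) (sq_nonneg _)) (fun i _ => le_of_eq (by ring))
  have h0 : 0 ≤ ∑ i, q i * x i ^ 2 :=
    Finset.sum_nonneg fun i _ => mul_nonneg (hq i) (sq_nonneg _)
  nlinarith

namespace IsSubord

variable {q l : ι → ℝ} {z z' w w' : ℂ}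

theorem im_sub (h : IsSubord q l z w) :
    (w - z).im = ∑ i, q i * ((l i : ℂ) - w)⁻¹.im := by
  have : w - z = ∑ i, (q i : ℂ) * ((l i : ℂ) - w)⁻¹ := by linear_combination h.eqn
  rw [this, Complex.im_sum]
  simp only [Complex.im_ofReal_mul]

theorem im_sub_nonneg (hq : ∀ i, 0 ≤ q i) (h : IsSubord q l z w) : 0 ≤ (w - z).im := by
  rw [h.im_sub]
  refine Finset.sum_nonneg fun i _ => mul_nonneg (hq i) ?_
  rw [im_inv_ofReal_sub]
  exact mul_nonneg h.im_pos.le (sq_nonneg _)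

/-- The imaginary part of the equation reads `Im w - Im z = Im w * ∑ qᵢ |lᵢ - w|⁻²`, and `Im z > 0`.
Every uniform bound below rests on this. -/
theorem sum_norm_sq_lt (hz : 0 < z.im) (h : IsSubord q l z w) :
    ∑ i, q i * ‖((l i : ℂ) - w)⁻¹‖ ^ 2 < 1 := by
  have h1 := h.im_sub
  simp only [im_inv_ofReal_sub, Complex.sub_im] at h1
  have h2 : ∑ i, q i * (w.im * ‖((l i : ℂ) - w)⁻¹‖ ^ 2)
      = w.im * ∑ i, q i * ‖((l i : ℂ) - w)⁻¹‖ ^ 2 := by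
    rw [Finset.mul_sum]; exact Finset.sum_congr rfl fun i _ => by ring
  rw [h2] at h1
  have := h.im_pos
  by_contra! hge
  nlinarith

theorem norm_sub_le (hq : ∀ i, 0 ≤ q i) (hq1 : ∑ i, q i ≤ 1) (hz : 0 < z.im)
    (h : IsSubord q l z w) : ‖w - z‖ ≤ 1 := by
  have h0 : w - z = ∑ i, (q i : ℂ) * ((l i : ℂ) - w)⁻¹ := by linear_combination h.eqn
  have h1 : ‖w - z‖ ≤ ∑ i, q i * ‖((l i : ℂ) - w)⁻¹‖ := by
    rw [h0]
    refine (norm_sum_le _ _).trans (Finset.sum_le_sum fun i _ => ?_)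
    rw [norm_mul, Complex.norm_real, Real.norm_of_nonneg (hq i)]
  have h2 := sq_sum_mul_le hq hq1 fun i => ‖((l i : ℂ) - w)⁻¹‖
  have h3 := h.sum_norm_sq_lt hz
  have h4 := norm_nonneg (w - z)
  nlinarith

/-- From `(|g|² + |g'|²) / 2 - Re (g g') = ((Re g - Re g')² + (Im g + Im g')²) / 2`. The retained
square quantifies the stability of the equation: it keeps `1 - S` away from zero wherever the
imaginary parts are not small. -/
theorem re_sum_mul_le (hq : ∀ i, 0 ≤ q i) (hz : 0 < z.im) (hz' : 0 < z'.im)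
    (h : IsSubord q l z w) (h' : IsSubord q l z' w') :
    (∑ i, (q i : ℂ) * (((l i : ℂ) - w)⁻¹ * ((l i : ℂ) - w')⁻¹)).re
      + (∑ i, q i * (((l i : ℂ) - w)⁻¹.im + ((l i : ℂ) - w')⁻¹.im) ^ 2) / 2 < 1 := by
  have s1 := h.sum_norm_sq_lt hz
  have s2 := h'.sum_norm_sq_lt hz'
  have key : (∑ i, (q i : ℂ) * (((l i : ℂ) - w)⁻¹ * ((l i : ℂ) - w')⁻¹)).re
      + (∑ i, q i * (((l i : ℂ) - w)⁻¹.im + ((l i : ℂ) - w')⁻¹.im) ^ 2) / 2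
      ≤ (∑ i, q i * ‖((l i : ℂ) - w)⁻¹‖ ^ 2 + ∑ i, q i * ‖((l i : ℂ) - w')⁻¹‖ ^ 2) / 2 := by
    rw [Complex.re_sum, ← Finset.sum_add_distrib, Finset.sum_div, Finset.sum_div,
      ← Finset.sum_add_distrib]
    refine Finset.sum_le_sum fun i _ => ?_
    generalize ((l i : ℂ) - w)⁻¹ = g
    generalize ((l i : ℂ) - w')⁻¹ = g'
    rw [Complex.re_ofReal_mul, Complex.mul_re, Complex.sq_norm, Complex.sq_norm,
      Complex.normSq_apply, Complex.normSq_apply]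
    nlinarith [mul_nonneg (hq i) (sq_nonneg (g.re - g'.re))]
  linarith

theorem sub_mul_one_sub (h : IsSubord q l z w) (h' : IsSubord q l z' w') :
    (w - w') * (1 - ∑ i, (q i : ℂ) * (((l i : ℂ) - w)⁻¹ * ((l i : ℂ) - w')⁻¹)) = z - z' := by
  have h1 : ∑ i, (q i : ℂ) * ((l i : ℂ) - w)⁻¹ - ∑ i, (q i : ℂ) * ((l i : ℂ) - w')⁻¹
      = (w - w') * ∑ i, (q i : ℂ) * (((l i : ℂ) - w)⁻¹ * ((l i : ℂ) - w')⁻¹) := by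
    rw [← Finset.sum_sub_distrib, Finset.mul_sum]
    refine Finset.sum_congr rfl fun i _ => ?_
    have a := ofReal_sub_ne_zero (l i) h.im_pos
    have b := ofReal_sub_ne_zero (l i) h'.im_pos
    field_simp
    ring
  linear_combination h.eqn - h'.eqn + h1

theorem one_sub_sum_ne_zero (hq : ∀ i, 0 ≤ q i) (hz : 0 < z.im) (hz' : 0 < z'.im)
    (h : IsSubord q l z w) (h' : IsSubord q l z' w') :
    1 - ∑ i, (q i : ℂ) * (((l i : ℂ) - w)⁻¹ * ((l i : ℂ) - w')⁻¹) ≠ 0 := by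
  intro h0
  have h1 := re_sum_mul_le hq hz hz' h h'
  have h2 : 0 ≤ ∑ i, q i * (((l i : ℂ) - w)⁻¹.im + ((l i : ℂ) - w')⁻¹.im) ^ 2 :=
    Finset.sum_nonneg fun i _ => mul_nonneg (hq i) (sq_nonneg _)
  rw [← sub_eq_zero.1 h0, Complex.one_re] at h1
  linarith

theorem unique (hq : ∀ i, 0 ≤ q i) (hz : 0 < z.im) (h : IsSubord q l z w)
    (h' : IsSubord q l z w') : w = w' := by
  have h1 := sub_mul_one_sub h h'
  rw [sub_self, mul_eq_zero] at h1
  exact sub_eq_zero.1 (h1.resolve_right (one_sub_sum_ne_zero hq hz hz h h'))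

/-- The imaginary part of the Stieltjes transform `w - z` is Hölder continuous with
exponent `1/3`, uniformly in the data. -/
theorem abs_im_sub_pow_three_le (hq : ∀ i, 0 ≤ q i) (hq1 : ∑ i, q i ≤ 1) (hz : 0 < z.im)
    (hz' : 0 < z'.im) (h : IsSubord q l z w) (h' : IsSubord q l z' w') :
    |(w - z).im - (w' - z').im| ^ 3 ≤ 2 * ‖z - z'‖ := by
  set S := ∑ i, (q i : ℂ) * (((l i : ℂ) - w)⁻¹ * ((l i : ℂ) - w')⁻¹) with hS
  have h1 := re_sum_mul_le hq hz hz' h h'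
  have h2 := sub_mul_one_sub h h'
  rw [← hS] at h1 h2
  have h3 := sq_sum_mul_le hq hq1 fun i => ((l i : ℂ) - w)⁻¹.im + ((l i : ℂ) - w')⁻¹.im
  have h4 : ∑ i, q i * (((l i : ℂ) - w)⁻¹.im + ((l i : ℂ) - w')⁻¹.im)
      = (w - z).im + (w' - z').im := by
    rw [h.im_sub, h'.im_sub, ← Finset.sum_add_distrib]
    exact Finset.sum_congr rfl fun i _ => by ring
  rw [h4] at h3
  have hSn : ‖S‖ ≤ 1 := by
    have : ‖S‖ ≤ (∑ i, q i * ‖((l i : ℂ) - w)⁻¹‖ ^ 2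
        + ∑ i, q i * ‖((l i : ℂ) - w')⁻¹‖ ^ 2) / 2 := by
      rw [hS, ← Finset.sum_add_distrib, Finset.sum_div]
      refine (norm_sum_le _ _).trans (Finset.sum_le_sum fun i _ => ?_)
      rw [norm_mul, norm_mul, Complex.norm_real, Real.norm_of_nonneg (hq i)]
      nlinarith [mul_nonneg (hq i)
        (sq_nonneg (‖((l i : ℂ) - w)⁻¹‖ - ‖((l i : ℂ) - w')⁻¹‖))]
    linarith [h.sum_norm_sq_lt hz, h'.sum_norm_sq_lt hz']
  -- The equation for the difference of the Stieltjes transforms. Since `‖S‖ ≤ 1`, only a lower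
  -- bound on `‖1 - S‖` is missing; it is quadratic in `a + b ≥ |a - b|`, which produces the
  -- exponent `3`.
  have h5 : ((w - z) - (w' - z')) * (1 - S) = (z - z') * S := by linear_combination h2
  have h6 : ‖(w - z) - (w' - z')‖ * ‖1 - S‖ ≤ ‖z - z'‖ := by
    rw [← norm_mul, h5, norm_mul]
    exact mul_le_of_le_one_right (norm_nonneg _) hSn
  have h7 : 1 - S.re ≤ ‖1 - S‖ := by
    simpa using Complex.re_le_norm (1 - S)
  have h8 : |(w - z).im - (w' - z').im| ≤ ‖(w - z) - (w' - z')‖ := by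
    simpa using Complex.abs_im_le_norm ((w - z) - (w' - z'))
  have a0 := im_sub_nonneg hq h
  have b0 := im_sub_nonneg hq h'
  generalize (w - z).im = a at *
  generalize (w' - z').im = b at *
  have h9 : |a - b| ≤ a + b := abs_le.2 ⟨by linarith, by linarith⟩
  have h10 : |a - b| ^ 2 ≤ 2 * ‖1 - S‖ := by
    have := pow_le_pow_left₀ (abs_nonneg _) h9 2
    linarith
  calc |a - b| ^ 3 = |a - b| * |a - b| ^ 2 := by ring
    _ ≤ ‖(w - z) - (w' - z')‖ * (2 * ‖1 - S‖) := by gcongr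
    _ ≤ 2 * ‖z - z'‖ := by linarith

end IsSubord

/-! ### The phase and its variation in atoms, weights and energy -/

/-- The subordination point of `z`. -/
def subord (q l : ι → ℝ) (z : ℂ) : ℂ := Classical.epsilon (IsSubord q l z)

theorem isSubord_subord (q l : ι → ℝ) {z : ℂ} (hz : 0 < z.im) :
    IsSubord q l z (subord q l z) :=
  Classical.epsilon_spec (exists_isSubord q l hz)

/-- The logarithmic potential, stationary in `w` at the subordination point of `z`. -/
def logPotential (q l : ι → ℝ) (z w : ℂ) : ℂ :=
  ∑ i, (q i : ℂ) * Complex.log (w - l i) + (w - z) ^ 2 / 2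

/-- The imaginary part of the logarithmic potential at the subordination point. -/
def phase (q l : ι → ℝ) (z : ℂ) : ℝ := (logPotential q l z (subord q l z)).im

/-- Implicit function theorem: the derivative of the equation in `w` is `1 - ∑ qᵢ (lᵢ - w)⁻²`,
nonzero by stability. Uniqueness in the upper half plane identifies the local branch with the chosen
`subord`. -/
theorem differentiableAt_subord {q l : ℝ → ι → ℝ} {z : ℝ → ℂ}
    (hqd : ∀ i, ContDiff ℝ 1 fun s => q s i) (hld : ∀ i, ContDiff ℝ 1 fun s => l s i)
    (hzd : ContDiff ℝ 1 z) (hq : ∀ s i, 0 ≤ q s i) (hz : ∀ s, 0 < (z s).im) (s : ℝ) :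
    DifferentiableAt ℝ (fun s => subord (q s) (l s) (z s)) s := by
  set w := subord (q s) (l s) (z s) with hw
  have hsub : IsSubord (q s) (l s) (z s) w := isSubord_subord _ _ (hz s)
  let F : ℝ × ℂ → ℂ := fun p =>
    p.2 - z p.1 - ∑ i, (q p.1 i : ℂ) * ((l p.1 i : ℂ) - p.2)⁻¹
  have hF0 : ∀ t v, F (t, v) = 0 ↔ v = z t + ∑ i, (q t i : ℂ) * ((l t i : ℂ) - v)⁻¹ := by
    intro t v
    simp only [F]
    constructor
    · intro h; linear_combination h
    · intro h; linear_combination h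
  have hFc : ContDiffAt ℝ 1 F (s, w) := by
    refine ((contDiffAt_snd.sub (hzd.contDiffAt.comp _ contDiffAt_fst))).sub
      (ContDiffAt.sum fun i _ => ContDiffAt.mul ?_ (ContDiffAt.inv ?_ ?_))
    · exact Complex.ofRealCLM.contDiff.contDiffAt.comp _
        ((hqd i).contDiffAt.comp _ contDiffAt_fst)
    · exact (Complex.ofRealCLM.contDiff.contDiffAt.comp _
        ((hld i).contDiffAt.comp _ contDiffAt_fst)).sub contDiffAt_snd
    · exact ofReal_sub_ne_zero _ hsub.im_pos
  have dF : HasStrictFDerivAt F (fderiv ℝ F (s, w)) (s, w) :=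
    hFc.hasStrictFDerivAt (by simp)
  set c : ℂ := 1 - ∑ i, (q s i : ℂ) * (((l s i : ℂ) - w)⁻¹ * ((l s i : ℂ) - w)⁻¹) with hc
  have hc0 : c ≠ 0 := IsSubord.one_sub_sum_ne_zero (hq s) (hz s) (hz s) hsub hsub
  have hpart : HasDerivAt (fun v => F (s, v)) c w := by
    refine ((hasDerivAt_id w).sub_const (z s)).sub (HasDerivAt.fun_sum fun i _ => ?_)
    have h1 := (((hasDerivAt_id w).const_sub (l s i : ℂ)).inv
      (ofReal_sub_ne_zero _ hsub.im_pos)).const_mul (q s i : ℂ)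
    refine h1.congr_deriv ?_
    simp only [id, neg_neg]
    field_simp
  have hinr : (fderiv ℝ F (s, w) ∘L .inr ℝ ℝ ℂ)
      = ((ContinuousLinearEquiv.smulLeft (R₁ := ℂ) (Units.mk0 c hc0) : ℂ ≃L[ℂ] ℂ).restrictScalars ℝ
        : ℂ →L[ℝ] ℂ) := by
    have h1 : HasFDerivAt (fun v => F (s, v)) (fderiv ℝ F (s, w) ∘L .inr ℝ ℝ ℂ) w :=
      dF.hasFDerivAt.comp w (hasFDerivAt_prodMk_right s w)
    refine h1.unique ?_
    refine (hpart.hasFDerivAt.restrictScalars ℝ).congr_fderiv ?_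
    ext
    simp [Units.smul_def, mul_comm]
  have hinv : (fderiv ℝ F (s, w) ∘L .inr ℝ ℝ ℂ).IsInvertible := ⟨_, hinr.symm⟩
  have hd := dF.hasStrictFDerivAt_implicitFunctionOfProdDomain hinv
  set φ := dF.implicitFunctionOfProdDomain hinv with hφ
  refine hd.hasFDerivAt.differentiableAt.congr_of_eventuallyEq ?_
  have e1 := dF.eventually_apply_implicitFunctionOfProdDomain hinv
  have e2 := dF.tendsto_implicitFunctionOfProdDomain hinv
  have e3 : ∀ᶠ t in 𝓝 s, 0 < (φ t).im :=
    (Complex.continuous_im.continuousAt.tendsto.comp e2).eventually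
      (lt_mem_nhds hsub.im_pos)
  filter_upwards [e1, e3] with t h1 h3
  refine (isSubord_subord (q t) (l t) (hz t)).unique (hq t) (hz t) ⟨h3, (hF0 _ _).1 ?_⟩
  rw [h1]
  exact (hF0 _ _).2 hsub.eqn

theorem mem_slitPlane_sub_ofReal (a : ℝ) {w : ℂ} (hw : 0 < w.im) :
    w - (a : ℂ) ∈ Complex.slitPlane :=
  Or.inr (by simpa using hw.ne')

/-- Envelope principle: the potential is stationary in `w`, so the derivative `w'` of the
subordination point cancels and only the explicit dependence on the data remains. -/
theorem hasDerivAt_phase {q l : ℝ → ι → ℝ} {z : ℝ → ℂ} {q' l' : ι → ℝ} {z' : ℂ}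
    (hqd : ∀ i, ContDiff ℝ 1 fun s => q s i) (hld : ∀ i, ContDiff ℝ 1 fun s => l s i)
    (hzd : ContDiff ℝ 1 z) (hq : ∀ s i, 0 ≤ q s i) (hz : ∀ s, 0 < (z s).im) {s : ℝ}
    (hq' : ∀ i, HasDerivAt (fun s => q s i) (q' i) s)
    (hl' : ∀ i, HasDerivAt (fun s => l s i) (l' i) s) (hz' : HasDerivAt z z' s) :
    HasDerivAt (fun s => phase (q s) (l s) (z s))
      (∑ i, (q' i : ℂ) * Complex.log (subord (q s) (l s) (z s) - l s i)
        + ∑ i, (q s i : ℂ) * ((l' i - z') * ((l s i : ℂ) - subord (q s) (l s) (z s))⁻¹)).im s := by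
  have hsub : IsSubord (q s) (l s) (z s) (subord (q s) (l s) (z s)) := isSubord_subord _ _ (hz s)
  have hwd := (differentiableAt_subord hqd hld hzd hq hz s).hasDerivAt
  set w' := deriv (fun s => subord (q s) (l s) (z s)) s
  have hU : HasDerivAt (fun s => logPotential (q s) (l s) (z s) (subord (q s) (l s) (z s)))
      (∑ i, (q' i : ℂ) * Complex.log (subord (q s) (l s) (z s) - l s i)
        + ∑ i, (q s i : ℂ) * ((l' i - z') * ((l s i : ℂ) - subord (q s) (l s) (z s))⁻¹)) s := by
    have h1 : ∀ i, HasDerivAt (fun s => (q s i : ℂ) * Complex.log (subord (q s) (l s) (z s) - l s i))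
        ((q' i : ℂ) * Complex.log (subord (q s) (l s) (z s) - l s i)
          + q s i * ((w' - l' i) / (subord (q s) (l s) (z s) - l s i))) s := fun i =>
      (hq' i).ofReal_comp.mul
        ((hwd.sub (hl' i).ofReal_comp).clog_real (mem_slitPlane_sub_ofReal _ hsub.im_pos))
    have h2 := (HasDerivAt.fun_sum fun i (_ : i ∈ Finset.univ) => h1 i).add
      (((hwd.sub hz').pow 2).div_const 2)
    refine h2.congr_deriv ?_
    rw [Finset.sum_add_distrib, add_assoc]
    congr 1
    simp only [Pi.sub_apply, Nat.add_one_sub_one, pow_one]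
    have h3 := hsub.eqn
    generalize subord (q s) (l s) (z s) = w at *
    have h4 : (w - z s) = ∑ i, (q s i : ℂ) * ((l s i : ℂ) - w)⁻¹ := by linear_combination h3
    have h5 : ∀ i, (q s i : ℂ) * ((w' - l' i) / (w - l s i))
        = (q s i : ℂ) * ((l' i - z') * ((l s i : ℂ) - w)⁻¹)
          - (w' - z') * ((q s i : ℂ) * ((l s i : ℂ) - w)⁻¹) := by
      intro i
      rw [← neg_sub (l s i : ℂ) w, div_neg, div_eq_mul_inv]
      ring
    rw [Finset.sum_congr rfl fun i _ => h5 i, Finset.sum_sub_distrib, ← Finset.mul_sum, ← h4]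
    push_cast
    ring
  exact Complex.imCLM.hasFDerivAt.comp_hasDerivAt s hU

theorem im_log_mem_Icc {w : ℂ} (hw : 0 < w.im) (a : ℝ) :
    (Complex.log (w - a)).im ∈ Set.Icc 0 Real.pi := by
  rw [Complex.log_im]
  exact ⟨Complex.arg_nonneg_iff.2 (by simpa using hw.le), Complex.arg_le_pi _⟩

/-- Cauchy-Schwarz together with `sum_norm_sq_lt`; the bound is uniform in `z`, so it survives the
limit to the real axis. -/
theorem im_sum_smul_le_sqrt {q l : ι → ℝ} {z w : ℂ} (hq : ∀ i, 0 ≤ q i) (hz : 0 < z.im)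
    (h : IsSubord q l z w) (x : ι → ℝ) :
    |(∑ i, (q i : ℂ) * (x i * ((l i : ℂ) - w)⁻¹)).im| ≤ √(∑ i, q i * x i ^ 2) := by
  refine Real.abs_le_sqrt ?_
  have h1 : (∑ i, (q i : ℂ) * (x i * ((l i : ℂ) - w)⁻¹)).im
      = ∑ i, q i * x i * ((l i : ℂ) - w)⁻¹.im := by
    rw [Complex.im_sum]
    refine Finset.sum_congr rfl fun i _ => ?_
    rw [Complex.im_ofReal_mul, Complex.im_ofReal_mul, mul_assoc]
  have h2 := Finset.sum_sq_le_sum_mul_sum_of_sq_le_mul Finset.univ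
    (r := fun i => q i * x i * ((l i : ℂ) - w)⁻¹.im)
    (f := fun i => q i * x i ^ 2) (g := fun i => q i * ((l i : ℂ) - w)⁻¹.im ^ 2)
    (fun i _ => mul_nonneg (hq i) (sq_nonneg _)) (fun i _ => mul_nonneg (hq i) (sq_nonneg _))
    (fun i _ => le_of_eq (by ring))
  have h3 : ∑ i, q i * ((l i : ℂ) - w)⁻¹.im ^ 2 ≤ 1 := by
    refine (Finset.sum_le_sum fun i _ => ?_).trans (h.sum_norm_sq_lt hz).le
    refine mul_le_mul_of_nonneg_left ?_ (hq i)
    exact sq_le_sq' (by linarith [neg_abs_le ((l i : ℂ) - w)⁻¹.im,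
      Complex.abs_im_le_norm ((l i : ℂ) - w)⁻¹])
      ((le_abs_self _).trans (Complex.abs_im_le_norm _))
  have h4 : 0 ≤ ∑ i, q i * x i ^ 2 :=
    Finset.sum_nonneg fun i _ => mul_nonneg (hq i) (sq_nonneg _)
  rw [h1]
  nlinarith

/-- Derivative of the phase when atoms and energy move along straight lines. -/
theorem hasDerivAt_phase_lineMap {q : ι → ℝ} (hq : ∀ i, 0 ≤ q i) (l d : ι → ℝ) (α : ℝ) {z : ℂ}
    (hz : 0 < z.im) (s : ℝ) :
    HasDerivAt (fun s : ℝ => phase q (fun i => l i + s * d i) (z + (s * α : ℝ)))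
      (∑ i, (q i : ℂ) * ((d i - α : ℝ) * ((l i + s * d i : ℝ)
        - subord q (fun i => l i + s * d i) (z + (s * α : ℝ)))⁻¹)).im s := by
  have h := hasDerivAt_phase (q := fun _ => q) (l := fun s i => l i + s * d i)
    (z := fun s : ℝ => z + (s * α : ℝ)) (q' := 0) (l' := d) (z' := α) (s := s)
    (fun i => contDiff_const) (fun i => by fun_prop)
    (contDiff_const.add (Complex.ofRealCLM.contDiff.comp (by fun_prop : ContDiff ℝ 1 fun s : ℝ => s * α)))
    (fun _ => hq) (fun s => by simpa using hz)
    (fun i => hasDerivAt_const _ _)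
    (fun i => by simpa using ((hasDerivAt_id s).mul_const (d i)).const_add (l i))
    (by simpa using (((hasDerivAt_id s).mul_const α).ofReal_comp).const_add z)
  simpa using h

theorem abs_phase_sub_le {q : ι → ℝ} (hq : ∀ i, 0 ≤ q i) (l l' : ι → ℝ) (α : ℝ) {z : ℂ}
    (hz : 0 < z.im) :
    |phase q l' (z + α) - phase q l z| ≤ √(∑ i, q i * (l' i - l i - α) ^ 2) := by
  have h := norm_image_sub_le_of_norm_deriv_le_segment_01'
    (f := fun s : ℝ => phase q (fun i => l i + s * (l' i - l i)) (z + (s * α : ℝ)))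
    (fun s _ => (hasDerivAt_phase_lineMap hq l (fun i => l' i - l i) α hz s).hasDerivWithinAt)
    (fun s _ => im_sum_smul_le_sqrt hq (by simpa using hz)
      (isSubord_subord _ _ (by simpa using hz)) _)
  simpa using h

/-- Along the linear path every charged atom moves to the right at most as fast as the energy, so
each term of the derivative is nonpositive. Atoms of weight zero are exempt because the lemma is
applied to truncated weights. -/
theorem phase_le_of_le_add {q : ι → ℝ} (hq : ∀ i, 0 ≤ q i) {l l' : ι → ℝ} {α : ℝ} {z : ℂ}
    (hz : 0 < z.im) (hl : ∀ i, q i ≠ 0 → l' i ≤ l i + α) :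
    phase q l' (z + α) ≤ phase q l z := by
  have hd := hasDerivAt_phase_lineMap hq l (fun i => l' i - l i) α hz
  have h := antitone_of_deriv_nonpos (fun s => (hd s).differentiableAt) (fun s => by
    rw [(hd s).deriv, Complex.im_sum]
    refine Finset.sum_nonpos fun i _ => ?_
    rw [Complex.im_ofReal_mul, Complex.im_ofReal_mul, im_inv_ofReal_sub]
    by_cases h0 : q i = 0
    · simp [h0]
    refine mul_nonpos_of_nonneg_of_nonpos (hq i) (mul_nonpos_of_nonpos_of_nonneg
      (by linarith [hl i h0]) (mul_nonneg ?_ (sq_nonneg _)))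
    exact (isSubord_subord q _ (by simpa using hz)).im_pos.le)
  simpa using h zero_le_one

/-- Interpolating with `s ^ 2` instead of `s` keeps the weights nonnegative for every real `s`, as
`hasDerivAt_phase` requires. The weight derivative is the argument of `w - lᵢ`, which lies in `[0,
π]`; hence the two bounds that follow. -/
theorem hasDerivAt_phase_weight {q q' : ι → ℝ} (hq : ∀ i, 0 ≤ q i) (hqq : ∀ i, q i ≤ q' i)
    (l : ι → ℝ) {z : ℂ} (hz : 0 < z.im) (s : ℝ) :
    HasDerivAt (fun s : ℝ => phase (fun i => q i + s ^ 2 * (q' i - q i)) l z)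
      (2 * s * ∑ i, (q' i - q i) * (Complex.log
        (subord (fun i => q i + s ^ 2 * (q' i - q i)) l z - l i)).im) s := by
  have h := hasDerivAt_phase (q := fun s i => q i + s ^ 2 * (q' i - q i)) (l := fun _ => l)
    (z := fun _ => z) (q' := fun i => 2 * s * (q' i - q i)) (l' := 0) (z' := 0) (s := s)
    (fun i => by fun_prop) (fun i => contDiff_const) contDiff_const
    (fun s i => add_nonneg (hq i) (mul_nonneg (sq_nonneg s) (sub_nonneg.2 (hqq i))))
    (fun _ => hz)
    (fun i => by simpa using (((hasDerivAt_id s).pow 2).mul_const (q' i - q i)).const_add (q i))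
    (fun i => hasDerivAt_const _ _) (hasDerivAt_const _ _)
  refine h.congr_deriv ?_
  simp only [Pi.zero_apply, Complex.ofReal_zero, sub_zero, zero_mul, mul_zero,
    Finset.sum_const_zero, add_zero, Complex.im_sum, Complex.im_ofReal_mul, Finset.mul_sum]
  exact Finset.sum_congr rfl fun i _ => by ring

theorem phase_mono_weight {q q' : ι → ℝ} (hq : ∀ i, 0 ≤ q i) (hqq : ∀ i, q i ≤ q' i)
    (l : ι → ℝ) {z : ℂ} (hz : 0 < z.im) : phase q l z ≤ phase q' l z := by
  have hd := hasDerivAt_phase_weight hq hqq l hz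
  have h := monotoneOn_of_deriv_nonneg (convex_Icc (0 : ℝ) 1)
    (fun s _ => (hd s).continuousAt.continuousWithinAt)
    (fun s _ => (hd s).differentiableAt.differentiableWithinAt) (fun s hs => by
      rw [interior_Icc] at hs
      rw [(hd s).deriv]
      refine mul_nonneg (by linarith [hs.1]) (Finset.sum_nonneg fun i _ =>
        mul_nonneg (sub_nonneg.2 (hqq i)) (im_log_mem_Icc ?_ _).1)
      exact (isSubord_subord _ l hz).im_pos)
  simpa using h (by simp) (by simp) zero_le_one

theorem phase_le_add_weight {q q' : ι → ℝ} (hq : ∀ i, 0 ≤ q i) (hqq : ∀ i, q i ≤ q' i)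
    (l : ι → ℝ) {z : ℂ} (hz : 0 < z.im) :
    phase q' l z ≤ phase q l z + Real.pi * ∑ i, (q' i - q i) := by
  have hd : ∀ s, HasDerivAt (fun s : ℝ => phase (fun i => q i + s ^ 2 * (q' i - q i)) l z
      - s ^ 2 * (Real.pi * ∑ i, (q' i - q i)))
      (2 * s * ∑ i, (q' i - q i) * ((Complex.log
        (subord (fun i => q i + s ^ 2 * (q' i - q i)) l z - l i)).im - Real.pi)) s := by
    intro s
    refine ((hasDerivAt_phase_weight hq hqq l hz s).sub
      (((hasDerivAt_id s).pow 2).mul_const (Real.pi * ∑ i, (q' i - q i)))).congr_deriv ?_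
    simp only [mul_sub, Finset.sum_sub_distrib, ← Finset.sum_mul, id]
    norm_num
    ring
  have h := antitoneOn_of_deriv_nonpos (convex_Icc (0 : ℝ) 1)
    (fun s _ => (hd s).continuousAt.continuousWithinAt)
    (fun s _ => (hd s).differentiableAt.differentiableWithinAt) (fun s hs => by
      rw [interior_Icc] at hs
      rw [(hd s).deriv]
      refine mul_nonpos_of_nonneg_of_nonpos (by linarith [hs.1]) (Finset.sum_nonpos fun i _ =>
        mul_nonpos_of_nonneg_of_nonpos (sub_nonneg.2 (hqq i)) (sub_nonpos.2 (im_log_mem_Icc ?_ _).2))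
      exact (isSubord_subord _ l hz).im_pos)
  have := h (by simp) (by simp) zero_le_one
  simp at this
  simp only [Finset.sum_sub_distrib]
  linarith

/-- Moving the atoms with a mean square error `V` costs at most an energy shift `τ` and a mass
`V / τ²`. -/
theorem phase_le_add_div_sq {q : ι → ℝ} (hq : ∀ i, 0 ≤ q i) (l l' : ι → ℝ) (α : ℝ) {τ : ℝ}
    (hτ : 0 < τ) {z : ℂ} (hz : 0 < z.im) :
    phase q l' (z + (α + τ : ℝ)) ≤
      phase q l z + Real.pi * ((∑ i, q i * (l' i - l i - α) ^ 2) / τ ^ 2) := by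
  classical
  -- Chebyshev: discard the atoms displaced by more than `α + τ`. Their mass is at most `V / τ²`,
  -- each unit of mass changes the phase by at most `π`, and the remaining atoms obey the monotone
  -- comparison.
  let p : ι → ℝ := fun i => if l' i ≤ l i + (α + τ) then q i else 0
  have hp : ∀ i, 0 ≤ p i := fun i => by simp only [p]; split_ifs <;> simp [hq]
  have hpq : ∀ i, p i ≤ q i := fun i => by simp only [p]; split_ifs <;> simp [hq]
  have h1 := phase_le_add_weight hp hpq l' (z := z + (α + τ : ℝ)) (by simpa using hz)
  have h2 := phase_le_of_le_add hp (l := l) (l' := l') (α := α + τ) hz (fun i hi => by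
    by_contra hc
    exact hi (if_neg hc))
  have h3 := phase_mono_weight hp hpq l hz
  have h4 : ∑ i, (q i - p i) ≤ (∑ i, q i * (l' i - l i - α) ^ 2) / τ ^ 2 := by
    rw [Finset.sum_div]
    refine Finset.sum_le_sum fun i _ => ?_
    have h0 : 0 ≤ q i * (l' i - l i - α) ^ 2 / τ ^ 2 :=
      div_nonneg (mul_nonneg (hq i) (sq_nonneg _)) (sq_nonneg _)
    simp only [p]
    split_ifs with hc
    · simpa using h0
    · rw [sub_zero, le_div_iff₀ (by positivity)]
      refine mul_le_mul_of_nonneg_left ?_ (hq i)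
      push Not at hc
      exact pow_le_pow_left₀ hτ.le (by linarith) 2
  have h5 := mul_le_mul_of_nonneg_left h4 Real.pi_pos.le
  linarith

/-! ### Boundary values of the Stieltjes transform -/

/-- The imaginary part of the Stieltjes transform at `E + iη`. -/
def stieltjesIm (q l : ι → ℝ) (η E : ℝ) : ℝ :=
  (subord q l (E + η * Complex.I) - (E + η * Complex.I)).im

/-- `ρ` is the boundary density of the free convolution with the semicircle law of the measure with
weights `q` and atoms `l`. -/
def HasDensity (q l : ι → ℝ) (ρ : ℝ → ℝ) : Prop :=
  ∀ E, Tendsto (fun η => stieltjesIm q l η E) (𝓝[>] 0) (𝓝 (Real.pi * ρ E))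

theorem im_add_mul_I_pos (E : ℝ) {η : ℝ} (hη : 0 < η) :
    0 < ((E : ℂ) + η * Complex.I).im := by simpa using hη

section

variable {q l : ι → ℝ}

theorem stieltjesIm_nonneg (hq : ∀ i, 0 ≤ q i) (E : ℝ) {η : ℝ} (hη : 0 < η) :
    0 ≤ stieltjesIm q l η E :=
  (isSubord_subord q l (im_add_mul_I_pos E hη)).im_sub_nonneg hq

theorem stieltjesIm_le_one (hq : ∀ i, 0 ≤ q i) (hq1 : ∑ i, q i ≤ 1) (E : ℝ) {η : ℝ}
    (hη : 0 < η) : stieltjesIm q l η E ≤ 1 :=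
  (le_abs_self _).trans <| (Complex.abs_im_le_norm _).trans <|
    (isSubord_subord q l (im_add_mul_I_pos E hη)).norm_sub_le hq hq1 (im_add_mul_I_pos E hη)

theorem abs_stieltjesIm_sub_energy (hq : ∀ i, 0 ≤ q i) (hq1 : ∑ i, q i ≤ 1) (E E' : ℝ) {η : ℝ}
    (hη : 0 < η) : |stieltjesIm q l η E - stieltjesIm q l η E'| ^ 3 ≤ 2 * |E - E'| := by
  have h := IsSubord.abs_im_sub_pow_three_le hq hq1 (im_add_mul_I_pos E hη)
    (im_add_mul_I_pos E' hη) (isSubord_subord q l (im_add_mul_I_pos E hη))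
    (isSubord_subord q l (im_add_mul_I_pos E' hη))
  rwa [add_sub_add_right_eq_sub, ← Complex.ofReal_sub, Complex.norm_real] at h

theorem abs_stieltjesIm_sub_height (hq : ∀ i, 0 ≤ q i) (hq1 : ∑ i, q i ≤ 1) (E : ℝ) {η η' : ℝ}
    (hη : 0 < η) (hη' : 0 < η') :
    |stieltjesIm q l η E - stieltjesIm q l η' E| ^ 3 ≤ 2 * |η - η'| := by
  have h := IsSubord.abs_im_sub_pow_three_le hq hq1 (im_add_mul_I_pos E hη)
    (im_add_mul_I_pos E hη') (isSubord_subord q l (im_add_mul_I_pos E hη))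
    (isSubord_subord q l (im_add_mul_I_pos E hη'))
  rwa [add_sub_add_left_eq_sub, ← sub_mul, norm_mul, Complex.norm_I, mul_one,
    ← Complex.ofReal_sub, Complex.norm_real] at h

/-- Hölder continuity in the height `η` gives the Cauchy property as `η → 0+`. -/
theorem exists_tendsto_stieltjesIm (hq : ∀ i, 0 ≤ q i) (hq1 : ∑ i, q i ≤ 1) (E : ℝ) :
    ∃ x, Tendsto (fun η => stieltjesIm q l η E) (𝓝[>] 0) (𝓝 x) := by
  rw [← cauchy_map_iff_exists_tendsto, cauchy_map_iff', Metric.uniformity_basis_dist.tendsto_right_iff]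
  intro ε hε
  have hmem : Set.Ioo (0 : ℝ) (ε ^ 3 / 2) ∈ 𝓝[>] (0 : ℝ) := Ioo_mem_nhdsGT (by positivity)
  filter_upwards [prod_mem_prod hmem hmem] with p hp
  obtain ⟨⟨h1, h2⟩, h3, h4⟩ := hp
  have h := abs_stieltjesIm_sub_height (l := l) hq hq1 E h1 h3
  refine lt_of_pow_lt_pow_left₀ 3 hε.le (lt_of_le_of_lt h ?_)
  have : |p.1 - p.2| < ε ^ 3 / 2 := abs_lt.2 ⟨by linarith, by linarith⟩
  linarith

theorem continuous_of_abs_sub_pow_three_le {f : ℝ → ℝ}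
    (hf : ∀ x y, |f x - f y| ^ 3 ≤ 2 * |x - y|) : Continuous f := by
  rw [Metric.continuous_iff]
  intro b ε hε
  refine ⟨ε ^ 3 / 2, by positivity, fun a ha => ?_⟩
  refine lt_of_pow_lt_pow_left₀ 3 hε.le (lt_of_le_of_lt (hf a b) ?_)
  rw [Real.dist_eq] at ha
  linarith

theorem hasDerivAt_phase_energy (hq : ∀ i, 0 ≤ q i) {η : ℝ} (hη : 0 < η) (E : ℝ) :
    HasDerivAt (fun E : ℝ => phase q l (E + η * Complex.I)) (-stieltjesIm q l η E) E := by
  have hz : 0 < (η * Complex.I : ℂ).im := by simpa using hη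
  have h := hasDerivAt_phase_lineMap hq l 0 1 hz E
  simp only [Pi.zero_apply, mul_zero, add_zero, mul_one, add_comm (η * Complex.I : ℂ)] at h
  refine h.congr_deriv ?_
  rw [stieltjesIm, (isSubord_subord q l (im_add_mul_I_pos E hη)).im_sub, Complex.im_sum,
    ← Finset.sum_neg_distrib]
  refine Finset.sum_congr rfl fun i _ => ?_
  rw [Complex.im_ofReal_mul, Complex.im_ofReal_mul]
  ring

theorem integral_stieltjesIm (hq : ∀ i, 0 ≤ q i) (hq1 : ∑ i, q i ≤ 1) {η : ℝ} (hη : 0 < η)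
    (a b : ℝ) : ∫ E in a..b, stieltjesIm q l η E
      = phase q l (a + η * Complex.I) - phase q l (b + η * Complex.I) := by
  have hc : Continuous (stieltjesIm q l η) :=
    continuous_of_abs_sub_pow_three_le fun x y => abs_stieltjesIm_sub_energy hq hq1 x y hη
  have h := intervalIntegral.integral_eq_sub_of_hasDerivAt
    (fun E _ => (hasDerivAt_phase_energy (l := l) hq hη E)) (hc.neg.intervalIntegrable a b)
  rw [intervalIntegral.integral_neg] at h
  linarith

end

/-! ### Normalization of the phase at `-∞` -/

theorem norm_ge_of_re_le {x : ℂ} {R : ℝ} (hR : 0 < R) (hx : x.re ≤ -R) : R ≤ ‖x‖ := by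
  have := Complex.abs_re_le_norm x
  rw [abs_of_neg (by linarith)] at this
  linarith

theorem pi_sub_arg_le {x : ℂ} {R : ℝ} (hR : 0 < R) (hre : x.re ≤ -R) (h0 : 0 ≤ x.im)
    (h2 : x.im ≤ 2) : Real.pi - x.arg ≤ Real.pi / R := by
  rw [Complex.arg_of_re_neg_of_im_nonneg (by linarith) h0, Complex.neg_im, neg_div,
    Real.arcsin_neg]
  have hn := norm_ge_of_re_le hR hre
  have hn0 : 0 < ‖x‖ := by linarith
  set t := x.im / ‖x‖ with ht
  have t0 : 0 ≤ t := by positivity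
  have t1 : t ≤ 1 := by
    rw [ht, div_le_one hn0]
    exact (le_abs_self _).trans (Complex.abs_im_le_norm x)
  have t2 : t ≤ 2 / R := by rw [ht]; gcongr
  have h3 := Real.mul_le_sin (Real.arcsin_nonneg.2 t0) (Real.arcsin_le_pi_div_two t)
  rw [Real.sin_arcsin (by linarith) t1] at h3
  have hpi := Real.pi_pos
  have h4 : Real.arcsin t ≤ Real.pi / 2 * t := by
    calc Real.arcsin t = Real.pi / 2 * (2 / Real.pi * Real.arcsin t) := by field_simp
      _ ≤ _ := by gcongr
  have h5 : Real.pi / 2 * t ≤ Real.pi / 2 * (2 / R) := by gcongr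
  have h6 : Real.pi / 2 * (2 / R) = Real.pi / R := by ring
  linarith

/-- Far to the left of all atoms every `w - lᵢ` has argument close to `π`, and the weights sum to
one. Uniformity in `η ≤ 1` lets one reference energy be fixed before `η → 0`. -/
theorem exists_abs_phase_sub_pi_le {q : ι → ℝ} (hq : ∀ i, 0 ≤ q i) (hq1 : ∑ i, q i = 1)
    (l : ι → ℝ) : ∃ L : ℝ, ∀ R, 1 ≤ R → ∀ a ≤ L - R, ∀ η : ℝ, 0 < η → η ≤ 1 →
      |phase q l (a + η * Complex.I) - Real.pi| ≤ 5 / R := by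
  obtain ⟨b, hb⟩ : ∃ b, ∀ i, b ≤ l i := by
    obtain ⟨b, hb⟩ := (Set.finite_range l).bddBelow
    exact ⟨b, fun i => hb ⟨i, rfl⟩⟩
  -- The margin `1` absorbs `‖w - z‖ ≤ 1`, so that `Re (w - lᵢ) ≤ -R`. The `5` in the bound is `4 /
  -- R` from the arguments (via `π ≤ 4`) plus `1 / R` from the quadratic term.
  refine ⟨b - 1, fun R hR a ha η hη hη1 => ?_⟩
  have hz := im_add_mul_I_pos a hη
  have hs := isSubord_subord q l hz
  have hm := hs.norm_sub_le hq hq1.le hz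
  rw [phase, logPotential]
  set z : ℂ := a + η * Complex.I with hzdef
  set w := subord q l z
  have hzre : z.re = a := by simp [hzdef]
  have hzim : z.im = η := by simp [hzdef]
  have hre : ∀ i, (w - l i).re ≤ -R := fun i => by
    have h1 := (le_abs_self _).trans ((Complex.abs_re_le_norm (w - z)).trans hm)
    simp only [Complex.sub_re, Complex.ofReal_re, hzre] at h1 ⊢
    linarith [hb i]
  have him : w.im ≤ 2 := by
    have h1 := (le_abs_self _).trans ((Complex.abs_im_le_norm (w - z)).trans hm)
    simp only [Complex.sub_im, hzim] at h1
    linarith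
  have hR0 : 0 < R := by linarith
  have hm2 : ‖w - z‖ ≤ 1 / R := by
    have h0 : w - z = ∑ i, (q i : ℂ) * ((l i : ℂ) - w)⁻¹ := by linear_combination hs.eqn
    rw [h0, one_div, ← one_mul R⁻¹, ← hq1, Finset.sum_mul]
    refine (norm_sum_le _ _).trans (Finset.sum_le_sum fun i _ => ?_)
    rw [norm_mul, Complex.norm_real, Real.norm_of_nonneg (hq i), norm_inv, norm_sub_rev]
    have := norm_ge_of_re_le hR0 (hre i)
    have := hq i
    gcongr
  have hsq : |((w - z) ^ 2 / 2).im| ≤ 1 / R := by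
    refine (Complex.abs_im_le_norm _).trans ?_
    rw [norm_div, norm_pow, Complex.norm_ofNat]
    have := norm_nonneg (w - z)
    nlinarith
  have hlog : (∑ i, (q i : ℂ) * Complex.log (w - l i)).im - Real.pi
      = - ∑ i, q i * (Real.pi - (w - l i).arg) := by
    simp only [mul_sub, Finset.sum_sub_distrib, ← Finset.sum_mul, hq1, Complex.im_sum,
      Complex.im_ofReal_mul, Complex.log_im]
    ring
  have h0 : 0 ≤ ∑ i, q i * (Real.pi - (w - l i).arg) :=
    Finset.sum_nonneg fun i _ => mul_nonneg (hq i) (sub_nonneg.2 (Complex.arg_le_pi _))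
  have h1 : ∑ i, q i * (Real.pi - (w - l i).arg) ≤ Real.pi / R := by
    rw [← one_mul (Real.pi / R), ← hq1, Finset.sum_mul]
    refine Finset.sum_le_sum fun i _ => mul_le_mul_of_nonneg_left ?_ (hq i)
    exact pi_sub_arg_le hR0 (hre i) (by simpa using hs.im_pos.le) (by simpa using him)
  have h2 : Real.pi / R ≤ 4 / R := by
    have := Real.pi_le_four
    gcongr
  have h3 : 5 / R = 4 / R + 1 / R := by ring
  rw [Complex.add_im, add_sub_right_comm, hlog]
  have := abs_le.1 hsq
  exact abs_le.2 ⟨by linarith, by linarith⟩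

/-! ### Distribution functions and stability of bulk quantiles -/

namespace HasDensity

variable {q l l' : ι → ℝ} {ρ ρ' : ℝ → ℝ}

theorem abs_sub_pow_three_le (hq : ∀ i, 0 ≤ q i) (hq1 : ∑ i, q i ≤ 1) (h : HasDensity q l ρ)
    (E E' : ℝ) : |Real.pi * ρ E - Real.pi * ρ E'| ^ 3 ≤ 2 * |E - E'| := by
  refine le_of_tendsto ((((h E).sub (h E')).abs).pow 3) ?_
  filter_upwards [self_mem_nhdsWithin] with η hη
  exact abs_stieltjesIm_sub_energy hq hq1 E E' hη

theorem continuous (hq : ∀ i, 0 ≤ q i) (hq1 : ∑ i, q i ≤ 1) (h : HasDensity q l ρ) :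
    Continuous ρ := by
  have := (continuous_of_abs_sub_pow_three_le (h.abs_sub_pow_three_le hq hq1)).const_mul
    (Real.pi)⁻¹
  simpa [← mul_assoc, Real.pi_ne_zero] using this

theorem nonneg (hq : ∀ i, 0 ≤ q i) (h : HasDensity q l ρ) (E : ℝ) : 0 ≤ ρ E := by
  have : 0 ≤ Real.pi * ρ E := by
    refine ge_of_tendsto (h E) ?_
    filter_upwards [self_mem_nhdsWithin] with η hη
    exact stieltjesIm_nonneg hq E hη
  exact nonneg_of_mul_nonneg_right this Real.pi_pos

theorem tendsto_phase_sub (hq : ∀ i, 0 ≤ q i) (hq1 : ∑ i, q i ≤ 1) (h : HasDensity q l ρ)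
    (a b : ℝ) : Tendsto (fun η : ℝ => phase q l (a + η * Complex.I) - phase q l (b + η * Complex.I))
      (𝓝[>] 0) (𝓝 (Real.pi * ∫ E in a..b, ρ E)) := by
  rw [← intervalIntegral.integral_const_mul]
  have ht : Tendsto (fun η => ∫ E in a..b, stieltjesIm q l η E) (𝓝[>] 0)
      (𝓝 (∫ E in a..b, Real.pi * ρ E)) := by
    refine intervalIntegral.tendsto_integral_filter_of_dominated_convergence (fun _ => 1) ?_ ?_
      (by simp) (.of_forall fun E _ => h E)
    · filter_upwards [self_mem_nhdsWithin] with η hη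
      exact (continuous_of_abs_sub_pow_three_le fun x y =>
        abs_stieltjesIm_sub_energy hq hq1 x y hη).aestronglyMeasurable
    · filter_upwards [self_mem_nhdsWithin] with η hη
      refine .of_forall fun E _ => ?_
      rw [Real.norm_of_nonneg (stieltjesIm_nonneg hq E hη)]
      exact stieltjesIm_le_one hq hq1 E hη
  refine ht.congr' ?_
  filter_upwards [self_mem_nhdsWithin] with η hη
  exact integral_stieltjesIm hq hq1 hη a b

/-- The boundary values of the phase give the distribution function. -/
theorem tendsto_phase (hq : ∀ i, 0 ≤ q i) (hq1 : ∑ i, q i = 1) (h : HasDensity q l ρ) {E : ℝ}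
    (hi : MeasureTheory.IntegrableOn ρ (Set.Iic E)) :
    Tendsto (fun η : ℝ => phase q l (E + η * Complex.I)) (𝓝[>] 0)
      (𝓝 (Real.pi - Real.pi * ∫ τ in Set.Iic E, ρ τ)) := by
  rw [Metric.tendsto_nhds]
  intro ε hε
  obtain ⟨L, hL⟩ := exists_abs_phase_sub_pi_le hq hq1 l
  set R := max 1 (15 / ε + 1) with hRdef
  have hR1 : 1 ≤ R := le_max_left _ _
  have hR : 5 / R < ε / 3 := by
    have : 15 / ε + 1 ≤ R := le_max_right _ _
    have h15 : 15 / ε < R := by linarith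
    rw [div_lt_iff₀ hε] at h15
    rw [div_lt_iff₀ (by linarith)]
    linarith
  have hlim := (MeasureTheory.intervalIntegral_tendsto_integral_Iic E hi tendsto_id).const_mul
    Real.pi
  -- Three errors of `ε / 3`: the tail of the integral left of `a`, the phase at `a` against `π`,
  -- and the convergence of the phase difference on `[a, E]`.
  obtain ⟨a, ha, haL⟩ := ((Metric.tendsto_nhds.1 hlim (ε / 3) (by positivity)).and
    (eventually_le_atBot (L - R))).exists
  filter_upwards [Metric.tendsto_nhds.1 (h.tendsto_phase_sub hq hq1.le a E) (ε / 3) (by positivity),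
    Ioc_mem_nhdsGT (zero_lt_one (α := ℝ))] with η h1 h2
  have h3 := hL R hR1 a haL η h2.1 h2.2
  simp only [id, Real.dist_eq] at ha h1 ⊢
  rw [abs_lt] at ha h1 ⊢
  rw [abs_le] at h3
  constructor <;> linarith [ha.1, ha.2, h1.1, h1.2, h3.1, h3.2]

theorem integral_Iic_le_add (hq : ∀ i, 0 ≤ q i) (hq1 : ∑ i, q i = 1) (h : HasDensity q l ρ)
    (h' : HasDensity q l' ρ') {β κ : ℝ}
    (hphase : ∀ z : ℂ, 0 < z.im → phase q l' (z + β) ≤ phase q l z + Real.pi * κ) {E : ℝ}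
    (hi : MeasureTheory.IntegrableOn ρ (Set.Iic E))
    (hi' : MeasureTheory.IntegrableOn ρ' (Set.Iic (E + β))) :
    ∫ τ in Set.Iic E, ρ τ ≤ (∫ τ in Set.Iic (E + β), ρ' τ) + κ := by
  have h1 := le_of_tendsto_of_tendsto (h'.tendsto_phase hq hq1 hi')
    ((h.tendsto_phase hq hq1 hi).add_const (Real.pi * κ)) (by
      filter_upwards [self_mem_nhdsWithin] with η hη
      have := hphase _ (im_add_mul_I_pos E hη)
      rwa [add_right_comm, ← Complex.ofReal_add] at this)
  have := Real.pi_pos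
  by_contra! hc
  nlinarith

theorem integrableOn_Iic (hq : ∀ i, 0 ≤ q i) (hq1 : ∑ i, q i ≤ 1) (h : HasDensity q l ρ)
    {a : ℝ} (hi : MeasureTheory.IntegrableOn ρ (Set.Iic a)) (b : ℝ) :
    MeasureTheory.IntegrableOn ρ (Set.Iic b) := by
  refine (hi.union ((h.continuous hq hq1).continuousOn.integrableOn_Icc (a := a) (b := b))).mono_set ?_
  intro x hx
  rcases le_total x a with hxa | hxa
  · exact Or.inl hxa
  · exact Or.inr ⟨hxa, hx⟩

theorem integral_Iic_mono (hq : ∀ i, 0 ≤ q i) (h : HasDensity q l ρ) {a b : ℝ} (hab : a ≤ b)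
    (hi : MeasureTheory.IntegrableOn ρ (Set.Iic b)) :
    ∫ τ in Set.Iic a, ρ τ ≤ ∫ τ in Set.Iic b, ρ τ :=
  MeasureTheory.setIntegral_mono_set hi (.of_forall fun x => h.nonneg hq x)
    (LE.le.eventuallyLE (Set.Iic_subset_Iic.2 hab))

/-- A drop of the density from `c` to below `c / 2` changes `π ρ` by more than `3c / 2`. As `(3c /
2)³ > 2c³`, the Hölder bound excludes this within distance `c³`. -/
theorem half_mul_le_integral (hq : ∀ i, 0 ≤ q i) (hq1 : ∑ i, q i ≤ 1) (h : HasDensity q l ρ)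
    {a c : ℝ} (hc : 0 < c) (hca : c ≤ ρ a) {e : ℝ} (he0 : 0 ≤ e) (he : e ≤ c ^ 3)
    (hi : MeasureTheory.IntegrableOn ρ (Set.Iic a)) :
    (∫ τ in Set.Iic a, ρ τ) + c / 2 * e ≤ ∫ τ in Set.Iic (a + e), ρ τ := by
  have hcont := h.continuous hq hq1
  have h1 := intervalIntegral.integral_Iic_sub_Iic hi (h.integrableOn_Iic hq hq1 hi (a + e))
  have h2 : ∫ _ in a..(a + e), c / 2 ≤ ∫ τ in a..(a + e), ρ τ := by
    refine intervalIntegral.integral_mono_on (by linarith) (by simp)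
      (hcont.intervalIntegrable _ _) fun x hx => ?_
    by_contra! hlt
    have h3 := h.abs_sub_pow_three_le hq hq1 a x
    have h4 : |a - x| ≤ e := abs_le.2 ⟨by linarith [hx.2], by linarith [hx.1]⟩
    have h5 : 3 * c / 2 ≤ |Real.pi * ρ a - Real.pi * ρ x| := by
      refine le_trans ?_ (le_abs_self _)
      nlinarith [Real.pi_gt_three]
    have h6 := pow_le_pow_left₀ (by positivity) h5 3
    have h7 : 0 < c ^ 3 := by positivity
    nlinarith
  rw [intervalIntegral.integral_const, smul_eq_mul] at h2
  linarith

/-- One-sided stability of a quantile lying in the bulk. -/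
theorem quantile_sub_le (hq : ∀ i, 0 ≤ q i) (hq1 : ∑ i, q i = 1) (h : HasDensity q l ρ)
    (h' : HasDensity q l' ρ') {α γ γ' c : ℝ} (hc : 0 < c) (hcγ : c ≤ ρ γ)
    (hi : MeasureTheory.IntegrableOn ρ (Set.Iic γ))
    (hi' : MeasureTheory.IntegrableOn ρ' (Set.Iic γ'))
    (heq : ∫ τ in Set.Iic γ, ρ τ = ∫ τ in Set.Iic γ', ρ' τ) :
    γ' - γ - α ≤ (1 / c + 2 / c ^ 2) * √(∑ i, q i * (l' i - l i - α) ^ 2) := by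
  set V := ∑ i, q i * (l' i - l i - α) ^ 2 with hV
  have hV0 : 0 ≤ V := Finset.sum_nonneg fun i _ => mul_nonneg (hq i) (sq_nonneg _)
  set σ := √V with hσ
  have hσ0 : 0 ≤ σ := Real.sqrt_nonneg _
  have hσV : σ ^ 2 = V := Real.sq_sqrt hV0
  by_contra! hlt
  have hpi := Real.pi_gt_three
  have hC0 : 0 ≤ 2 / c ^ 2 * σ := by positivity
  have hC1 : 0 ≤ 1 / c * σ := by positivity
  have hd : 0 ≤ γ' - γ - α := by nlinarith
  -- The excess displacement, truncated to the window where the density is at least `c / 2`. The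
  -- mass gained there is at most `σ / π`, whence `e ≤ σ / c`.
  set e := min (γ' - γ - α) (c ^ 3) with he
  have he0 : 0 ≤ e := le_min hd (by positivity)
  have hie := h.integrableOn_Iic hq hq1.le hi
  have hie' := h'.integrableOn_Iic hq hq1.le hi'
  have g1 := h.half_mul_le_integral hq hq1.le hc hcγ he0 (min_le_right _ _) hi
  have g2 := h.integral_Iic_le_add hq hq1 h' (β := α) (κ := σ / Real.pi) (fun z hz => by
    have := (le_abs_self _).trans (abs_phase_sub_le hq l l' α hz)
    rw [mul_div_cancel₀ _ Real.pi_ne_zero]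
    linarith) (hie (γ + e)) (hie' _)
  have g3 := h'.integral_Iic_mono hq (a := γ + e + α) (b := γ')
    (by linarith [min_le_left (γ' - γ - α) (c ^ 3)]) hi'
  have g4 : σ / Real.pi ≤ σ / 2 := by gcongr; linarith
  have g5 : c * e ≤ σ := by linarith
  have g6 : e ≤ 1 / c * σ := by
    rw [one_div, inv_mul_eq_div, le_div_iff₀ hc]
    linarith
  rcases le_total (γ' - γ - α) (c ^ 3) with hle | hge
  · rw [he, min_eq_left hle] at g6
    linarith
  rw [min_eq_right hge] at he
  have hec : 0 < e := by rw [he]; positivity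
  have hσpos : 0 < σ := lt_of_lt_of_le (mul_pos hc hec) g5
  -- Truncated case, `e = c³`. This `τ` makes the Chebyshev loss `c⁴ / 4`, strictly less than the
  -- gained mass `c⁴ / 2`. The assumed displacement exceeds `e + τ`, so monotonicity of the
  -- distribution function gives the contradiction.
  set τ := 2 / c ^ 2 * σ with hτ
  have hτ0 : 0 < τ := by positivity
  have hκ : V / τ ^ 2 = c ^ 4 / 4 := by
    rw [hτ, ← hσV]
    field_simp
    norm_num
  have g7 := h.integral_Iic_le_add hq hq1 h' (β := α + τ) (κ := V / τ ^ 2)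
    (fun z hz => phase_le_add_div_sq hq l l' α hτ0 hz) (hie (γ + e)) (hie' _)
  have g8 := h'.integral_Iic_mono hq (a := γ + e + (α + τ)) (b := γ') (by linarith) hi'
  have hc4 : 0 < c ^ 4 := by positivity
  have : c / 2 * e = c ^ 4 / 2 := by rw [he]; ring
  linarith

end HasDensity

end

/-! ### The matrix Dyson equation and the coupling of spectra -/

section

variable {N : ℕ}

theorem trace_eq_sum_inv_of_inv_mul {D M : Matrix (Fin N) (Fin N) ℂ} (hD : D.IsHermitian) {w : ℂ}
    (hw : 0 < w.im) (hM : (D - w • (1 : Matrix (Fin N) (Fin N) ℂ)) * M = 1) :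
    M.trace = ∑ i, ((hD.eigenvalues i : ℂ) - w)⁻¹ := by
  set U : Matrix (Fin N) (Fin N) ℂ := (hD.eigenvectorUnitary : Matrix (Fin N) (Fin N) ℂ) with hU
  have hUU : star U * U = 1 := Unitary.coe_star_mul_self hD.eigenvectorUnitary
  have hUU' : U * star U = 1 := Unitary.coe_mul_star_self hD.eigenvectorUnitary
  set L : Matrix (Fin N) (Fin N) ℂ := Matrix.diagonal fun i => (hD.eigenvalues i : ℂ) with hL
  set R : Matrix (Fin N) (Fin N) ℂ :=
    Matrix.diagonal fun i => ((hD.eigenvalues i : ℂ) - w)⁻¹ with hR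
  have hDU : D = U * L * star U := by
    have := hD.spectral_theorem
    rw [Unitary.conjStarAlgAut_apply] at this
    exact this
  have hRL : R * (L - w • (1 : Matrix (Fin N) (Fin N) ℂ)) = 1 := by
    rw [hL, hR, ← Matrix.diagonal_one, ← Matrix.diagonal_smul, Matrix.diagonal_sub,
      Matrix.diagonal_mul_diagonal]
    congr 1
    ext i
    simp [ofReal_sub_ne_zero (hD.eigenvalues i) hw]
  have h1 : (L - w • (1 : Matrix (Fin N) (Fin N) ℂ)) * (star U * M * U) = 1 := by
    have h2 : (L - w • (1 : Matrix (Fin N) (Fin N) ℂ)) * star U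
        = star U * (D - w • (1 : Matrix (Fin N) (Fin N) ℂ)) := by
      rw [hDU, sub_mul, mul_sub, ← mul_assoc, ← mul_assoc, hUU, one_mul, smul_mul_assoc,
        mul_smul_comm, one_mul, mul_one]
    rw [← mul_assoc, ← mul_assoc, h2, mul_assoc (star U), hM, mul_one, hUU]
  have h3 : star U * M * U = R := by
    rw [← one_mul (star U * M * U), ← hRL, mul_assoc, h1, mul_one]
  have h4 : M.trace = R.trace := by
    rw [← h3, Matrix.trace_mul_comm, ← mul_assoc, hUU', one_mul]
  rw [h4, hR, Matrix.trace_diagonal]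

theorem IsMDESolution.normTr_im_pos (hN : 0 < N) {D M : Matrix (Fin N) (Fin N) ℂ} {z : ℂ}
    (hz : 0 < z.im) (h : IsMDESolution D z M) : 0 < (normTr M).im := by
  have hN' : (N : ℂ)⁻¹ = ((N : ℝ)⁻¹ : ℝ) := by push_cast; rfl
  have : Nonempty (Fin N) := ⟨⟨0, hN⟩⟩
  have ht := h.pos.trace_pos
  rw [Matrix.trace_smul, Complex.real_smul, Complex.pos_iff, Complex.re_ofReal_mul] at ht
  rw [← normTr_im, normTr, hN', Complex.re_ofReal_mul]
  exact mul_pos (by positivity) (pos_of_mul_pos_right ht.1 hz.le)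

/-- The Dyson equation with deterministic part `D` is the subordination equation for any weighted
family of atoms that represents the eigenvalue distribution of `D`. -/
theorem IsMDESolution.isSubord (hN : 0 < N) {D M : Matrix (Fin N) (Fin N) ℂ}
    (hD : D.IsHermitian) {z : ℂ} (hz : 0 < z.im) (h : IsMDESolution D z M) {ι : Type*} [Fintype ι]
    {q l : ι → ℝ}
    (hql : ∀ f : ℝ → ℂ, ∑ i, (q i : ℂ) * f (l i) = (N : ℂ)⁻¹ * ∑ j, f (hD.eigenvalues j)) :
    IsSubord q l z (z + normTr M) := by
  have hw : 0 < (z + normTr M).im := by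
    rw [Complex.add_im]
    exact add_pos hz (h.normTr_im_pos hN hz)
  refine ⟨hw, ?_⟩
  rw [hql fun x => ((x : ℂ) - (z + normTr M))⁻¹, ← trace_eq_sum_inv_of_inv_mul hD hw h.inv_mul]
  rfl

/-- Uniqueness of the subordination point identifies the two Stieltjes transforms, and existence of
the limit makes the `limUnder` in `scDos` a genuine limit. Arbitrary weighted atoms are allowed so
that two matrices can share one index set and one weight. -/
theorem hasDensity_scDos (hN : 0 < N) {D : Matrix (Fin N) (Fin N) ℂ} (hD : D.IsHermitian)
    {ι : Type*} [Fintype ι] {q l : ι → ℝ} (hq : ∀ i, 0 ≤ q i) (hq1 : ∑ i, q i ≤ 1)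
    (hql : ∀ f : ℝ → ℂ, ∑ i, (q i : ℂ) * f (l i) = (N : ℂ)⁻¹ * ∑ j, f (hD.eigenvalues j)) :
    HasDensity q l (scDos D) := by
  intro E
  have hev : (fun η => (1 / Real.pi) * stieltjesIm q l η E) =ᶠ[𝓝[>] 0] fun η : ℝ =>
      (1 / Real.pi) *
        (normTr (ℑ (mdeSol D (E + η * Complex.I)) : Matrix (Fin N) (Fin N) ℂ)).re := by
    filter_upwards [self_mem_nhdsWithin] with η hη
    have hz := im_add_mul_I_pos E hη
    rw [normTr_im, stieltjesIm, (isSubord_subord q l hz).unique hq hz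
      ((mdeSol_spec hD hz).isSubord hN hD hz hql), add_sub_cancel_left]
  obtain ⟨x, hx⟩ := exists_tendsto_stieltjesIm (l := l) hq hq1 E
  have h1 := tendsto_nhds_limUnder ⟨_, (hx.const_mul (1 / Real.pi)).congr' hev⟩
  have h2 := (h1.congr' hev.symm).const_mul Real.pi
  refine h2.congr fun η => ?_
  rw [← mul_assoc, mul_one_div_cancel Real.pi_ne_zero, one_mul]

theorem sum_norm_sq_row {Q : Matrix (Fin N) (Fin N) ℂ} (hQ : Q * star Q = 1) (j : Fin N) :
    ∑ k, ‖Q j k‖ ^ 2 = 1 := by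
  have h := congrFun (congrFun hQ j) j
  rw [Matrix.mul_apply, Matrix.one_apply_eq] at h
  simp only [Matrix.star_apply, Complex.star_def, Complex.mul_conj'] at h
  exact_mod_cast h

theorem sum_norm_sq_col {Q : Matrix (Fin N) (Fin N) ℂ} (hQ : star Q * Q = 1) (k : Fin N) :
    ∑ j, ‖Q j k‖ ^ 2 = 1 := by
  have h := congrFun (congrFun hQ k) k
  rw [Matrix.mul_apply, Matrix.one_apply_eq] at h
  simp only [Matrix.star_apply, Complex.star_def, Complex.conj_mul'] at h
  exact_mod_cast h

/-- A coupling of the eigenvalue distributions of two Hermitian matrices whose quadratic cost is the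
normalized Hilbert-Schmidt distance of the matrices. -/
theorem exists_eigenvalue_coupling (hN : 0 < N) {X Y : Matrix (Fin N) (Fin N) ℂ}
    (hX : X.IsHermitian) (hY : Y.IsHermitian) (α : ℝ) :
    ∃ q : Fin N × Fin N → ℝ, (∀ p, 0 ≤ q p) ∧ ∑ p, q p = 1 ∧
      (∀ f : ℝ → ℂ, ∑ p, (q p : ℂ) * f (hX.eigenvalues p.1)
        = (N : ℂ)⁻¹ * ∑ j, f (hX.eigenvalues j)) ∧
      (∀ f : ℝ → ℂ, ∑ p, (q p : ℂ) * f (hY.eigenvalues p.2)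
        = (N : ℂ)⁻¹ * ∑ j, f (hY.eigenvalues j)) ∧
      ∑ p, q p * (hY.eigenvalues p.2 - hX.eigenvalues p.1 - α) ^ 2
        = (normTr ((Y - X - (α : ℂ) • (1 : Matrix (Fin N) (Fin N) ℂ)) ^ 2)).re := by
  set U : Matrix (Fin N) (Fin N) ℂ := (hX.eigenvectorUnitary : Matrix (Fin N) (Fin N) ℂ) with hU
  set V : Matrix (Fin N) (Fin N) ℂ := (hY.eigenvectorUnitary : Matrix (Fin N) (Fin N) ℂ) with hV
  have hUU : star U * U = 1 := Unitary.coe_star_mul_self hX.eigenvectorUnitary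
  have hUU' : U * star U = 1 := Unitary.coe_mul_star_self hX.eigenvectorUnitary
  have hVV : star V * V = 1 := Unitary.coe_star_mul_self hY.eigenvectorUnitary
  have hVV' : V * star V = 1 := Unitary.coe_mul_star_self hY.eigenvectorUnitary
  set K : Matrix (Fin N) (Fin N) ℂ := Matrix.diagonal fun i => (hX.eigenvalues i : ℂ) with hK
  set L : Matrix (Fin N) (Fin N) ℂ := Matrix.diagonal fun i => (hY.eigenvalues i : ℂ) with hL
  have hXU : X = U * K * star U := by
    have := hX.spectral_theorem
    rw [Unitary.conjStarAlgAut_apply] at this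
    exact this
  have hYV : Y = V * L * star V := by
    have := hY.spectral_theorem
    rw [Unitary.conjStarAlgAut_apply] at this
    exact this
  set Q := star U * V with hQdef
  have hQ : Q * star Q = 1 := by
    rw [hQdef, star_mul, star_star, mul_assoc, ← mul_assoc V, hVV', one_mul, hUU]
  have hQ' : star Q * Q = 1 := by
    rw [hQdef, star_mul, star_star, mul_assoc, ← mul_assoc U, hUU', one_mul, hVV]
  set Z := Y - X - (α : ℂ) • (1 : Matrix (Fin N) (Fin N) ℂ) with hZ
  have hZh : Z.conjTranspose = Z := by
    rw [hZ, Matrix.conjTranspose_sub, Matrix.conjTranspose_sub, hX.eq, hY.eq,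
      Matrix.conjTranspose_smul, Matrix.conjTranspose_one, Complex.star_def, Complex.conj_ofReal]
  -- In the mixed eigenbases `Z` has entries `Q j k * (μ_k - λ_j - α)`, with `λ` and `μ` the
  -- eigenvalues of `X` and `Y`. Its Hilbert-Schmidt norm is therefore the quadratic cost for the
  -- weights `N⁻¹ |Q j k|²`; the marginals are uniform because `Q` is unitary.
  have hW : star U * Z * V = Q * L - K * Q - (α : ℂ) • Q := by
    have e1 : star U * Y * V = Q * L := by
      rw [hYV, hQdef]
      simp only [mul_assoc, hVV, mul_one]
    have e2 : star U * X * V = K * Q := by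
      rw [hXU, hQdef]
      simp only [← mul_assoc, hUU, one_mul]
    rw [hZ, mul_sub, mul_sub, sub_mul, sub_mul, e1, e2, mul_smul_comm, mul_one, smul_mul_assoc]
  have htr : (Z ^ 2).trace
      = ((star U * Z * V).conjTranspose * (star U * Z * V)).trace := by
    rw [← Matrix.star_eq_conjTranspose, star_mul, star_mul, star_star,
      Matrix.star_eq_conjTranspose Z, hZh]
    have : star V * (Z * U) * (star U * Z * V) = star V * (Z ^ 2 * V) := by
      rw [pow_two]
      simp only [mul_assoc]
      rw [← mul_assoc U, hUU', one_mul]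
    rw [this, Matrix.trace_mul_comm, mul_assoc, hVV', mul_one]
  have hNr : (N : ℝ) ≠ 0 := by positivity
  refine ⟨fun p => (N : ℝ)⁻¹ * ‖Q p.1 p.2‖ ^ 2, fun p => by positivity, ?_, fun f => ?_,
    fun f => ?_, ?_⟩
  · rw [← Finset.mul_sum, Fintype.sum_prod_type]
    simp only [sum_norm_sq_row hQ]
    simp [hNr]
  · rw [Fintype.sum_prod_type, Finset.mul_sum]
    refine Finset.sum_congr rfl fun j _ => ?_
    dsimp only
    rw [← Finset.sum_mul, ← Complex.ofReal_sum, ← Finset.mul_sum]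
    simp only [sum_norm_sq_row hQ, mul_one, Complex.ofReal_inv, Complex.ofReal_natCast]
  · rw [Fintype.sum_prod_type, Finset.sum_comm, Finset.mul_sum]
    refine Finset.sum_congr rfl fun k _ => ?_
    dsimp only
    rw [← Finset.sum_mul, ← Complex.ofReal_sum, ← Finset.mul_sum]
    simp only [sum_norm_sq_col hQ', mul_one, Complex.ofReal_inv, Complex.ofReal_natCast]
  · have hN' : (N : ℂ)⁻¹ = ((N : ℝ)⁻¹ : ℝ) := by push_cast; rfl
    rw [normTr, htr, trace_conjTranspose_mul, hN', ← Complex.ofReal_mul, Complex.ofReal_re,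
      Fintype.sum_prod_type, Finset.mul_sum]
    refine Finset.sum_congr rfl fun j _ => ?_
    rw [Finset.mul_sum]
    refine Finset.sum_congr rfl fun k _ => ?_
    have hjk : (star U * Z * V) j k
        = Q j k * ((hY.eigenvalues k - hX.eigenvalues j - α : ℝ) : ℂ) := by
      rw [hW, Matrix.sub_apply, Matrix.sub_apply, Matrix.smul_apply, hL, hK, Matrix.mul_diagonal,
        Matrix.diagonal_mul, smul_eq_mul]
      push_cast
      ring
    rw [hjk, norm_mul, mul_pow, Complex.norm_real, Real.norm_eq_abs, sq_abs, mul_assoc]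

/-- Stability of bulk quantiles of the self-consistent density of states. -/
theorem abs_quantile_sub_le (hN : 0 < N) {X Y : Matrix (Fin N) (Fin N) ℂ} (hX : X.IsHermitian)
    (hY : Y.IsHermitian) (α : ℝ) {i : ℕ} {γ γ' c : ℝ} (hc : 0 < c)
    (hγ : IsQuantile (scDos X) N i γ) (hγ' : IsQuantile (scDos Y) N i γ')
    (hcγ : c ≤ scDos X γ) (hcγ' : c ≤ scDos Y γ') :
    |γ' - (γ + α)| ≤ (1 / c + 2 / c ^ 2) *
      √(normTr ((Y - X - (α : ℂ) • (1 : Matrix (Fin N) (Fin N) ℂ)) ^ 2)).re := by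
  obtain ⟨q, hq, hq1, hqX, hqY, hV⟩ := exists_eigenvalue_coupling hN hX hY α
  have dX : HasDensity q (fun p => hX.eigenvalues p.1) (scDos X) :=
    hasDensity_scDos hN hX hq hq1.le hqX
  have dY : HasDensity q (fun p => hY.eigenvalues p.2) (scDos Y) :=
    hasDensity_scDos hN hY hq hq1.le hqY
  have h1 := dX.quantile_sub_le hq hq1 dY (α := α) hc hcγ hγ.1 hγ'.1 (hγ.2.trans hγ'.2.symm)
  -- The reverse inequality: exchanging the roles with shift `-α` leaves the cost unchanged.
  have h2 := dY.quantile_sub_le hq hq1 dX (α := -α) hc hcγ' hγ'.1 hγ.1 (hγ'.2.trans hγ.2.symm)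
  have hV' : ∑ p, q p * (hX.eigenvalues p.1 - hY.eigenvalues p.2 - -α) ^ 2
      = ∑ p, q p * (hY.eigenvalues p.2 - hX.eigenvalues p.1 - α) ^ 2 :=
    Finset.sum_congr rfl fun p _ => by ring
  rw [hV', hV] at h2
  rw [hV] at h1
  exact abs_le.2 ⟨by linarith, by linarith⟩

/-- For Hermitian `A` the number `⟨A⟩` is real, so the shift `α = t ⟨A⟩` removes exactly the scalar
part of `t • A`. -/
theorem normTr_smul_traceless_sq {A : Matrix (Fin N) (Fin N) ℂ} (hA : A.IsHermitian) (t : ℝ) :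
    (normTr ((t • A - ((t * (normTr A).re : ℝ) : ℂ) • (1 : Matrix (Fin N) (Fin N) ℂ)) ^ 2)).re
      = t ^ 2 * (normTr (traceless A ^ 2)).re := by
  have him : (normTr A).im = 0 := by
    rw [← normTr_im]
    have : (ℑ A : Matrix (Fin N) (Fin N) ℂ) = 0 := by
      rw [imaginaryPart_apply_coe, Matrix.star_eq_conjTranspose, hA.eq]
      simp
    rw [this, normTr]
    simp
  have hre : (((normTr A).re : ℝ) : ℂ) = normTr A := Complex.ext (by simp) (by simp [him])
  have h1 : t • A - ((t * (normTr A).re : ℝ) : ℂ) • (1 : Matrix (Fin N) (Fin N) ℂ)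
      = t • traceless A := by
    rw [traceless, Complex.ofReal_mul, hre, smul_sub, ← smul_smul, Complex.coe_smul]
  rw [h1, smul_pow, normTr, normTr, Matrix.trace_smul, Complex.real_smul, mul_left_comm,
    Complex.re_ofReal_mul]

end

end Monoparametric

end

theorem lemma3p2 (c₁ : ℝ) (hc₁ : 0 < c₁) :
    ∃ cstar : ℝ, 0 < cstar ∧ ∀ C₀ : ℝ, ∃ C : ℝ, 0 < C ∧
      ∀ (N : ℕ) (B A : Matrix (Fin N) (Fin N) ℂ), B.IsHermitian → A.IsHermitian →
        ‖Matrix.toEuclideanCLM (n := Fin N) (𝕜 := ℂ) B‖ ≤ C₀ →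
        ∀ x₁ x₂ : ℝ, |x₁ - x₂| ≤ cstar →
        ∀ i : ℕ, 1 ≤ i → i ≤ N →
        ∀ γ₁ γ₂ : ℝ,
          IsQuantile (scDos (B + x₁ • A)) N i γ₁ → IsQuantile (scDos (B + x₂ • A)) N i γ₂ →
          c₁ ≤ scDos (B + x₁ • A) γ₁ → c₁ ≤ scDos (B + x₂ • A) γ₂ →
          |γ₁ - (γ₂ + (x₁ - x₂) * (normTr A).re)| ≤
            C * (|x₁ - x₂| * Real.sqrt (normTr (traceless A ^ 2)).re + |x₁ - x₂| ^ 2) := by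
  -- The constant is that of `abs_quantile_sub_le`. That estimate is not perturbative, so the value
  -- `1` for `cstar` is an arbitrary choice.
  refine ⟨1, one_pos, fun _ => ⟨1 / c₁ + 2 / c₁ ^ 2, by positivity, ?_⟩⟩
  intro N B A hB hA _ x₁ x₂ _ i hi1 hiN γ₁ γ₂ hγ₁ hγ₂ hc₁γ hc₂γ
  have hsmul : ∀ x : ℝ, (x • A).IsHermitian := fun x => by
    rw [Matrix.IsHermitian, Matrix.conjTranspose_smul, hA.eq, star_trivial]
  have h := abs_quantile_sub_le (by omega) (hB.add (hsmul x₂)) (hB.add (hsmul x₁))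
    ((x₁ - x₂) * (normTr A).re) hc₁ hγ₂ hγ₁ hc₂γ hc₁γ
  rw [add_sub_add_left_eq_sub, ← sub_smul, normTr_smul_traceless_sq hA,
    Real.sqrt_mul (sq_nonneg _), Real.sqrt_sq_eq_abs] at h
  refine h.trans (mul_le_mul_of_nonneg_left ?_ (by positivity))
  -- The linear term alone already bounds the error; the quadratic term is slack.
  exact le_add_of_nonneg_right (by positivity)
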